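/- Setting. Let $\mathbf F$ be the set of binary floating point numbers with precision $q$, i.e. the reals $m\,2^e$ with $m,e\in\mathbb Z$, $|m|<2^q$, $e\ge e_{\min}$, let $\mathrm{fl}:\mathbb R\to\mathbf F$ be rounding to nearest (any tie-breaking rule), and let $\mathbf u=2^{-q}$. Write $a\oplus b=\mathrm{fl}(a+b)$, $a\ominus b=\mathrm{fl}(a-b)$, $a\otimes b=\mathrm{fl}(ab)$. An operation underflows if its exact result is smaller in modulus than the smallest positive normal number $2^{e_{\min}+q-1}$ and is not in $\mathbf F$. Let $[S,\sigma]=\mathtt{TwoSum}(a,b)$ be Knuth's algorithm, $S=a\oplus b$, $z=S\ominus a$, $\sigma=(a\ominus(S\ominus z))\oplus(b\ominus z)$, and let $[P,\pi]=\mathtt{TwoProd}(a,b)$ be Dekker's algorithm: $P=a\otimes b$, $\pi=a_\ell\otimes b_\ell\ominus(((P\ominus a_h\otimes b_h)\ominus a_\ell\otimes b_h)\ominus a_h\otimes b_\ell)$, where $a$ is split by $z=a\otimes(2^r+1)$, $a_h=z\ominus(z\ominus a)$, $a_\ell=a\ominus a_h$, $r=\lceil q/2\rceil$, and similarly $b$.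 Sums $x\oplus y\oplus\cdots$ are evaluated from left to right. Algorithm $\mathtt{CompDeCasteljauK}(p,s,K)$, $K\ge1$. Input: $s\in\mathbf F$ and Bernstein coefficients $b_0,\dots,b_n\in\mathbf F$. Compute $[\widehat r,\rho]=\mathtt{TwoSum}(1,-s)$; put $\widehat b_j^{(n)}=b_j$ and $\widehat{\partial F}_j^{(n)}=0$ for $1\le F\le K-1$. For $k=n-1,\dots,0$ and $j=0,\dots,k$: compute $[P_1,\pi_1]=\mathtt{TwoProd}(\widehat r,\widehat b_j^{(k+1)})$, $[P_2,\pi_2]=\mathtt{TwoProd}(s,\widehat b_{j+1}^{(k+1)})$, $[\widehat b_j^{(k)},\sigma_3]=\mathtt{TwoSum}(P_1,P_2)$; put $e=(\pi_1,\pi_2,\sigma_3)$, $\delta b=\widehat b_j^{(k+1)}$; then for $F=1,\dots,K-1$ compute $$\widehat\ell=e_1\oplus\cdots\oplus e_L\oplus(\rho\otimes\delta b),\qquad \widehat{\partial F}_j^{(k)}=\widehat\ell\oplus\bigl(s\otimes\widehat{\partial F}_{j+1}^{(k+1)}\bigr)\oplus\bigl(\widehat r\otimes\widehat{\partial F}_j^{(k+1)}\bigr),$$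 where $L$ is the length of $e$. If $F<K-1$, every $\oplus$ and $\otimes$ here is done by $\mathtt{TwoSum}$ and $\mathtt{TwoProd}$, and afterwards $e$ is replaced by the list of all resulting round-off errors in the order errors of $e_1\oplus\cdots\oplus e_L$, of $\rho\otimes\delta b$, of its addition, of $s\otimes\cdot$, of its addition, of $\widehat r\otimes\cdot$, of its addition, and $\delta b$ is replaced by $\widehat{\partial F}_j^{(k+1)}$; if $F=K-1$, ordinary operations are used. The result is $\mathtt{SumK}(v,K)$ for $v=(\widehat b_0^{(0)},\widehat{\partial 1}_0^{(0)},\dots,\widehat{\partial(K-1)}_0^{(0)})$: perform $K-1$ times the pass "for $j=2,\dots,K$: $[v_j,v_{j-1}]=\mathtt{TwoSum}(v_j,v_{j-1})$", then return $v_1\oplus\cdots\oplus v_K$. (For $K=1$ there are no error terms and the computed value is that of the ordinary de Casteljau algorithm.) Theorem. Let $p(s)=\sum_{j=0}^n b_jB_{j,n}(s)$ with $B_{j,n}(s)=\binom nj(1-s)^{n-j}s^j$, and $\operatorname{cond}(p,s)=\sum_{j=0}^n|b_j|B_{j,n}(s)/|p(s)|$. If no operation underflows (and overflow is excluded), $n\ge2$,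 $s\in[0,1]$ and $p(s)\ne0$, then, as $\mathbf u\to0$, $$\frac{|p(s)-\mathtt{CompDeCasteljauK}(p,s,K)|}{|p(s)|}\le\bigl[\mathbf u+O(\mathbf u^2)\bigr]+\Bigl[\Bigl(3^K\tbinom nK+O(n^{K-1})\Bigr)\mathbf u^K+O(\mathbf u^{K+1})\Bigr]\operatorname{cond}(p,s).$$ Precisely: for every $K\ge1$ there are constants $C_1,C_2$ depending only on $K$ such that for every $n\ge2$ there are $C_3$ and $u_0>0$ depending only on $K,n$ such that, for every such floating point arithmetic with $\mathbf u\le u_0$ and all $b_0,\dots,b_n,s\in\mathbf F$ as above, the left-hand side is at most $\mathbf u+C_1\mathbf u^2+\bigl[(3^K\binom nK+C_2n^{K-1})\mathbf u^K+C_3\mathbf u^{K+1}\bigr]\operatorname{cond}(p,s)$. -/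

import Mathlib

noncomputable section

/-- The binary floating point numbers with `prec` bits of precision and smallest exponent `emin`
(subnormal numbers included; there is no largest exponent, so overflow does not exist). -/
def IsFloat (prec : ℕ) (emin : ℤ) (x : ℝ) : Prop :=
  ∃ m e : ℤ, |m| < 2 ^ prec ∧ emin ≤ e ∧ x = (m : ℝ) * (2 : ℝ) ^ e

/-- A binary floating point arithmetic with rounding to nearest. `fl x` is a floating point number
closest to `x`; the rule for breaking ties is arbitrary. -/
structure FloatArith where
  prec : ℕ
  emin : ℤ
  fl : ℝ → ℝ
  fl_isFloat : ∀ x, IsFloat prec emin (fl x)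
  fl_nearest : ∀ x y, IsFloat prec emin y → |x - fl x| ≤ |x - y|

/-- The outcome of a floating point computation: the computed value, together with the proposition
that none of the floating point operations executed on the way underflowed. -/
structure FloatRun (α : Type) where
  val : α
  noUnderflow : Prop

instance : Monad FloatRun where
  pure a := ⟨a, True⟩
  bind x f := ⟨(f x.val).val, x.noUnderflow ∧ (f x.val).noUnderflow⟩

namespace FloatArith

variable (A : FloatArith)

/-- The unit round-off. -/
def unitRoundoff : ℝ := (2 : ℝ) ^ (-(A.prec : ℤ))

/-- An operation with exact result `x` underflows if `x` is smaller in modulus than the smallest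
positive normal number and is not representable. -/
def Underflows (x : ℝ) : Prop :=
  |x| < (2 : ℝ) ^ (A.emin + (A.prec : ℤ) - 1) ∧ A.fl x ≠ x

/-- A single floating point operation whose exact result is `x`. -/
def round (x : ℝ) : FloatRun ℝ := ⟨A.fl x, ¬ A.Underflows x⟩

/-- `a ⊕ b` -/
def add (a b : ℝ) : FloatRun ℝ := A.round (a + b)

/-- `a ⊖ b` -/
def sub (a b : ℝ) : FloatRun ℝ := A.round (a - b)

/-- `a ⊗ b` -/
def mul (a b : ℝ) : FloatRun ℝ := A.round (a * b)

/-- Knuth's error-free transformation of a sum: `(S, σ)`, with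
`σ = (a ⊖ (S ⊖ z)) ⊕ (b ⊖ z)` and `z = S ⊖ a`. -/
def twoSum (a b : ℝ) : FloatRun (ℝ × ℝ) := do
  let S ← A.add a b
  let z ← A.sub S a
  let w ← A.sub S z
  let x ← A.sub a w
  let y ← A.sub b z
  let σ ← A.add x y
  return (S, σ)

/-- Splitting of a floating point number into a high and a low part, with the splitting constant
`2 ^ r + 1`, `r = ⌈prec / 2⌉` (so `r = 27` for double precision). -/
def split (a : ℝ) : FloatRun (ℝ × ℝ) := do
  let z ← A.mul a (2 ^ ((A.prec + 1) / 2) + 1)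
  let d ← A.sub z a
  let h ← A.sub z d
  let l ← A.sub a h
  return (h, l)

/-- Dekker's error-free transformation of a product: `(P, π)`, with
`π = aₗ ⊗ bₗ ⊖ (((P ⊖ aₕ ⊗ bₕ) ⊖ aₗ ⊗ bₕ) ⊖ aₕ ⊗ bₗ)`. -/
def twoProd (a b : ℝ) : FloatRun (ℝ × ℝ) := do
  let P ← A.mul a b
  let (ah, al) ← A.split a
  let (bh, bl) ← A.split b
  let hh ← A.mul ah bh
  let t₁ ← A.sub P hh
  let lh ← A.mul al bh
  let t₂ ← A.sub t₁ lh
  let hl ← A.mul ah bl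
  let t₃ ← A.sub t₂ hl
  let ll ← A.mul al bl
  let π ← A.sub ll t₃
  return (P, π)

/-- `acc ⊕ e₁ ⊕ e₂ ⊕ ⋯`, from left to right. -/
def sumFrom : ℝ → List ℝ → FloatRun ℝ
  | acc, [] => return acc
  | acc, x :: xs => do
    let S ← A.add acc x
    sumFrom S xs

/-- `acc ⊕ e₁ ⊕ e₂ ⊕ ⋯`, from left to right, each addition being done by `TwoSum`; the round-off
errors are returned in the order in which they arise. -/
def sumFromEFT : ℝ → List ℝ → FloatRun (ℝ × List ℝ)
  | acc, [] => return (acc, [])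
  | acc, x :: xs => do
    let (S, σ) ← A.twoSum acc x
    let (l, η) ← sumFromEFT S xs
    return (l, σ :: η)

/-- Floating point summation of a list from left to right. -/
def sum : List ℝ → FloatRun ℝ
  | [] => return 0
  | x :: xs => A.sumFrom x xs

/-- Floating point summation of a list from left to right, by `TwoSum`, with the round-off errors. -/
def sumEFT : List ℝ → FloatRun (ℝ × List ℝ)
  | [] => return (0, [])
  | x :: xs => A.sumFromEFT x xs

/-- `VecSum` with `c` in the place of the current `p_{j-1}` and the list `p_j, p_{j+1}, …` still
to be treated. -/
def vecSumFrom : ℝ → List ℝ → FloatRun (List ℝ)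
  | c, [] => return [c]
  | c, x :: xs => do
    let (S, σ) ← A.twoSum x c
    let rest ← vecSumFrom S xs
    return σ :: rest

/-- Error-free vector transformation for summation. -/
def vecSum : List ℝ → FloatRun (List ℝ)
  | [] => return []
  | x :: xs => A.vecSumFrom x xs

/-- `m` passes of `VecSum`, followed by ordinary summation. -/
def sumAfterPasses : ℕ → List ℝ → FloatRun ℝ
  | 0, v => A.sum v
  | m + 1, v => do
    let w ← A.vecSum v
    sumAfterPasses m w

/-- Summation as in `K`-fold precision: `K - 1` passes of `VecSum`, then ordinary summation. -/
def sumK (v : List ℝ) (K : ℕ) : FloatRun ℝ := A.sumAfterPasses (K - 1) v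

/-- The local error `e₁ ⊕ ⋯ ⊕ e_L ⊕ (ρ ⊗ δb)`, computed without tracking round-off. -/
def localError (e : List ℝ) (ρ δb : ℝ) : FloatRun ℝ := do
  let l ← A.sum e
  let P ← A.mul ρ δb
  A.add l P

/-- The local error `e₁ ⊕ ⋯ ⊕ e_L ⊕ (ρ ⊗ δb)` together with all round-off errors
`η₁, …, η_{L+1}` generated: `(η, ℓ)`. -/
def localErrorEFT (e : List ℝ) (ρ δb : ℝ) : FloatRun (List ℝ × ℝ) := do
  let (l, η) ← A.sumEFT e
  let (P, π) ← A.twoProd ρ δb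
  let (l', σ) ← A.twoSum l P
  return (η ++ [π, σ], l')

/-- The inner loop over the error groups at one node `(k, j)`. Given are the round-off errors `e`
and the term `δb` coming from the group above, and the list of the pairs
`(∂F_j^{(k+1)}, ∂F_{j+1}^{(k+1)})` for the error groups `F` still to be treated; the output is the
list of the corresponding `∂F_j^{(k)}`. All groups but the last are computed with error-free
transformations, the last one with ordinary operations. -/
def errorGroups (s r ρ : ℝ) : List ℝ → ℝ → List (ℝ × ℝ) → FloatRun (List ℝ)
  | _, _, [] => return []
  | e, δb, [(x, y)] => do
    let l ← A.localError e ρ δb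
    let P₁ ← A.mul s y
    let S₂ ← A.add l P₁
    let P₃ ← A.mul r x
    let d ← A.add S₂ P₃
    return [d]
  | e, δb, (x, y) :: z :: zs => do
    let (η, l) ← A.localErrorEFT e ρ δb
    let (P₁, π₁) ← A.twoProd s y
    let (S₂, σ₂) ← A.twoSum l P₁
    let (P₃, π₃) ← A.twoProd r x
    let (d, σ₄) ← A.twoSum S₂ P₃
    let rest ← errorGroups s r ρ (η ++ [π₁, σ₂, π₃, σ₄]) x (z :: zs)
    return d :: rest

/-- The values held at a node `(k, j)`: the coefficient `b̂_j^{(k)}`, and the list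
`∂1_j^{(k)}, …, ∂(K-1)_j^{(k)}` of the computed errors. -/
structure Node where
  coeff : ℝ
  errs : List ℝ

/-- One update: node `(k, j)` from `X`, the node `(k+1, j)`, and `Y`, the node `(k+1, j+1)`. -/
def update (s r ρ : ℝ) (X Y : Node) : FloatRun Node := do
  let (P₁, π₁) ← A.twoProd r X.coeff
  let (P₂, π₂) ← A.twoProd s Y.coeff
  let (c, σ₃) ← A.twoSum P₁ P₂
  let ds ← A.errorGroups s r ρ [π₁, π₂, σ₃] X.coeff (X.errs.zip Y.errs)
  return ⟨c, ds⟩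

/-- The node at position `j` after `m` rounds of updates, that is the node `(n - m, j)`. -/
def node (b : ℕ → ℝ) (K : ℕ) (s r ρ : ℝ) : ℕ → ℕ → FloatRun Node
  | 0, j => return ⟨b j, List.replicate (K - 1) 0⟩
  | m + 1, j => do
    let X ← node b K s r ρ m j
    let Y ← node b K s r ρ m (j + 1)
    A.update s r ρ X Y

/-- The `K`-fold compensated de Casteljau algorithm for the Bernstein coefficients
`b 0, …, b n`. For `K = 1` there are no error groups and the computed value is that of the
ordinary de Casteljau algorithm. -/
def compDeCasteljauK (n : ℕ) (b : ℕ → ℝ) (s : ℝ) (K : ℕ) : FloatRun ℝ := do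
  let (r, ρ) ← A.twoSum 1 (-s)
  let N ← A.node b K s r ρ n 0
  A.sumK (N.coeff :: N.errs) K

end FloatArith

/-- `p(s) = ∑ b_j B_{j,n}(s)` -/
def bernsteinEval (n : ℕ) (b : ℕ → ℝ) (s : ℝ) : ℝ :=
  ∑ j ∈ Finset.range (n + 1), b j * (bernsteinPolynomial ℝ n j).eval s

/-- The relative condition number `p̃(s) / |p(s)|`, where `p̃(s) = ∑ |b_j| B_{j,n}(s)`. -/
def bernsteinCond (n : ℕ) (b : ℕ → ℝ) (s : ℝ) : ℝ :=
  bernsteinEval n (fun j => |b j|) s / |bernsteinEval n b s|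

end

/-! Without underflow, `TwoSum` and `TwoProd` are error-free: value plus returned error is the exact
result, and the error is at most `u` times it. Hence at each node the computed coefficient plus the
computed errors `∂1, …, ∂(K-1)` obeys the exact de Casteljau recursion up to a remainder. Each group
receives the round-off errors of the group above, together with `ρ ⊗ δb`, which corrects the use of
`r` in place of `1 - s`; only what the last group loses is never recovered
(`isErrorGroups_errorGroups`).

Let `T` be the de Casteljau value for the moduli of the coefficients. After `m` rounds `∂F` is
bounded by `f_F(m) u^F T` and the total defect by `f_K(m) u^K T`, up to a factor that is a power of
`1 + u` (`isNodeBound_node`). With `a_F` for the local errors, the coefficients satisfy `f_F(m+1) =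
f_F(m) + a_F(m)`, `a_{F+1} = c a_F + 3 f_F`, `f_0 = 1`, `a_0 = 0`, where `c` depends on `K` only.
The 3 counts the round-off errors that a value suffers on its way to the next round. The term `c
a_F` has lower order in `m`, so Pascal's rule gives `f_K(n) = 3^K binom(n, K) + O(n^(K-1))`
(`exists_errCoeff_le`).

The final summation adds `(u + O(u^2))|∑ v|` and a multiple of `u^K T`, the multiple depending on
`K` alone to leading order (`exists_sumAfterPasses_bound`). Dividing by `|p(s)|` yields the claim.

Exactness of the two transformations comes from one principle: a number on the grid `2^e ℤ` of
modulus at most `2^(p+e)` is representable, so an operation with such a result commits no error. -/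

/-! ### Dyadic grids -/

/-- `x` is an integer multiple of `2 ^ e`. -/
def OnGrid (e : ℤ) (x : ℝ) : Prop := ∃ m : ℤ, x = m * (2 : ℝ) ^ e

namespace OnGrid

variable {e f : ℤ} {x y : ℝ}

theorem zero (e : ℤ) : OnGrid e 0 := ⟨0, by simp⟩

theorem two_zpow (e : ℤ) : OnGrid e ((2 : ℝ) ^ e) := ⟨1, by simp⟩

theorem neg (hx : OnGrid e x) : OnGrid e (-x) := by
  obtain ⟨m, rfl⟩ := hx
  exact ⟨-m, by push_cast; ring⟩

theorem add (hx : OnGrid e x) (hy : OnGrid e y) : OnGrid e (x + y) := by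
  obtain ⟨m, rfl⟩ := hx
  obtain ⟨k, rfl⟩ := hy
  exact ⟨m + k, by push_cast; ring⟩

theorem sub (hx : OnGrid e x) (hy : OnGrid e y) : OnGrid e (x - y) := by
  rw [sub_eq_add_neg]
  exact hx.add hy.neg

theorem mul (hx : OnGrid e x) (hy : OnGrid f y) : OnGrid (e + f) (x * y) := by
  obtain ⟨m, rfl⟩ := hx
  obtain ⟨k, rfl⟩ := hy
  exact ⟨m * k, by rw [zpow_add₀ two_ne_zero]; push_cast; ring⟩

theorem mono (hx : OnGrid f x) (h : e ≤ f) : OnGrid e x := by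
  obtain ⟨m, rfl⟩ := hx
  obtain ⟨k, rfl⟩ := Int.le.dest h
  exact ⟨m * 2 ^ k, by rw [zpow_add₀ two_ne_zero, zpow_natCast]; push_cast; ring⟩

theorem abs (hx : OnGrid e x) : OnGrid e |x| := by
  rcases abs_choice x with h | h <;> rw [h]
  exacts [hx, hx.neg]

theorem le_of_lt_add (hx : OnGrid e x) (hy : OnGrid e y) (h : x < y + 2 ^ e) : x ≤ y := by
  obtain ⟨m, rfl⟩ := hx
  obtain ⟨k, rfl⟩ := hy
  have he : (0 : ℝ) < 2 ^ e := by positivity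
  rw [← add_one_mul] at h
  have h1 : (m : ℝ) < k + 1 := lt_of_mul_lt_mul_right h he.le
  have h2 : m < k + 1 := by exact_mod_cast h1
  have h3 : (m : ℝ) ≤ k := by exact_mod_cast Int.lt_add_one_iff.1 h2
  gcongr

theorem abs_le_sub_one_zpow {p : ℕ} (hx : OnGrid e x) (h : |x| < (2 : ℝ) ^ (p + e)) :
    |x| ≤ (2 : ℝ) ^ (p + e) - 2 ^ e := by
  obtain ⟨m, rfl⟩ := hx
  have he : (0 : ℝ) < 2 ^ e := by positivity
  rw [abs_mul, abs_of_pos he, zpow_add₀ two_ne_zero, zpow_natCast] at *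
  have h1 : |(m : ℝ)| < 2 ^ p := lt_of_mul_lt_mul_right h he.le
  have h2 : |m| < 2 ^ p := by exact_mod_cast h1
  have h3 : |m| + 1 ≤ 2 ^ p := h2
  have h4 : |(m : ℝ)| + 1 ≤ 2 ^ p := by exact_mod_cast h3
  nlinarith

end OnGrid

/-! ### Rounding to nearest with unbounded exponents, and exactness of `TwoSum` -/

/-- Floating point numbers with `p` bits and unbounded exponent range. -/
def IsFlt (p : ℕ) (x : ℝ) : Prop := ∃ e : ℤ, OnGrid e x ∧ |x| < (2 : ℝ) ^ (p + e)

/-- `y` is an element of `IsFlt p` nearest to `x`. -/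
structure IsNearest (p : ℕ) (x y : ℝ) : Prop where
  isFlt : IsFlt p y
  abs_sub_le : ∀ z, IsFlt p z → |x - y| ≤ |x - z|

section UnboundedFloat

variable {p : ℕ} {e : ℤ} {x y a b : ℝ}

theorem isFlt_zero (p : ℕ) : IsFlt p 0 := ⟨0, .zero 0, by rw [abs_zero]; positivity⟩

theorem IsFlt.neg (hx : IsFlt p x) : IsFlt p (-x) := by
  obtain ⟨e, h, h'⟩ := hx
  exact ⟨e, h.neg, by rwa [abs_neg]⟩

/-- The endpoint `2 ^ (p + e)` needs `p + 1` bits on the grid `e`, but as a power of two it is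
representable with a larger exponent. Admitting it spares boundary cases in the exactness proofs. -/
theorem OnGrid.isFlt (hp : 1 ≤ p) (hx : OnGrid e x) (h : |x| ≤ (2 : ℝ) ^ (p + e)) :
    IsFlt p x := by
  rcases h.lt_or_eq with h | h
  · exact ⟨e, hx, h⟩
  · refine ⟨p + e, ?_, ?_⟩
    · rcases abs_choice x with h' | h' <;> rw [h'] at h
      · rw [h]; exact .two_zpow _
      · rw [← neg_neg x, h]; exact (OnGrid.two_zpow _).neg
    · rw [h]
      exact zpow_lt_zpow_right₀ one_lt_two (by omega)

theorem isFlt_two_zpow (hp : 1 ≤ p) (e : ℤ) : IsFlt p ((2 : ℝ) ^ e) :=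
  (OnGrid.two_zpow e).isFlt hp <| by
    rw [abs_of_pos (by positivity)]
    exact zpow_le_zpow_right₀ one_le_two (by omega)

theorem isFlt_one (hp : 1 ≤ p) : IsFlt p 1 := by simpa using isFlt_two_zpow hp 0

theorem IsFlt.onGrid (hx : IsFlt p x) (h : (2 : ℝ) ^ (p + e - 1) ≤ |x|) : OnGrid e x := by
  obtain ⟨f, h1, h2⟩ := hx
  refine h1.mono ?_
  have := (zpow_lt_zpow_iff_right₀ (one_lt_two (α := ℝ))).1 (h.trans_lt h2)
  omega

/-- A nonzero floating point number can be normalized. -/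
theorem IsFlt.exists_normalized (hx : IsFlt p x) (h0 : x ≠ 0) :
    ∃ e : ℤ, OnGrid e x ∧ (2 : ℝ) ^ (p + e - 1) ≤ |x| ∧ |x| < (2 : ℝ) ^ (p + e) := by
  obtain ⟨n, h1, h2⟩ := exists_mem_Ico_zpow (abs_pos.2 h0) (one_lt_two (α := ℝ))
  have h3 : (p : ℤ) + (n + 1 - p) = n + 1 := by ring
  have h4 : (2 : ℝ) ^ ((p : ℤ) + (n + 1 - p) - 1) ≤ |x| := by
    rwa [h3, add_sub_cancel_right]
  exact ⟨n + 1 - p, hx.onGrid h4, h4, by rwa [h3]⟩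

/-- Two floating point numbers lie on a common grid fine enough for the smaller one. -/
theorem IsFlt.exists_common_grid (ha : IsFlt p a) (hb : IsFlt p b) (h : |a| ≤ |b|) :
    ∃ e : ℤ, OnGrid e a ∧ OnGrid e b ∧ |a| < (2 : ℝ) ^ (p + e) := by
  obtain ⟨e, he, he'⟩ := ha
  obtain ⟨f, hf, hf'⟩ := hb
  rcases le_total e f with hef | hef
  · exact ⟨e, he, hf.mono hef, he'⟩
  · exact ⟨f, he.mono hef, hf, h.trans_lt hf'⟩

namespace IsNearest

theorem eq_of_isFlt (h : IsNearest p x y) (hx : IsFlt p x) : y = x := by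
  have := h.abs_sub_le x hx
  rw [sub_self, abs_zero] at this
  linarith [abs_nonpos_iff.1 this]

theorem eq_of_onGrid (h : IsNearest p x y) (hp : 1 ≤ p) (hx : OnGrid e x)
    (hx' : |x| ≤ (2 : ℝ) ^ (p + e)) : y = x :=
  h.eq_of_isFlt (hx.isFlt hp hx')

/-- The competitor is the multiple of `2 ^ e` nearest to `x`; it does not leave the interval `|·| ≤
2 ^ (p + e)`, so it is representable. -/
theorem abs_sub_le_half (h : IsNearest p x y) (hp : 1 ≤ p) (hx : |x| ≤ (2 : ℝ) ^ (p + e)) :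
    |x - y| ≤ (2 : ℝ) ^ (e - 1) := by
  have he : (0 : ℝ) < 2 ^ e := by positivity
  have hz : IsFlt p ((round (x / 2 ^ e) : ℤ) * (2 : ℝ) ^ e) := by
    refine OnGrid.isFlt hp ⟨_, rfl⟩ ?_
    rw [abs_mul, abs_of_pos he, zpow_add₀ two_ne_zero, zpow_natCast] at *
    gcongr
    have h1 : |x / 2 ^ e| ≤ 2 ^ p := by
      rwa [abs_div, abs_of_pos he, div_le_iff₀ he]
    have h2 : |round (x / 2 ^ e)| ≤ 2 ^ p := by
      rw [abs_le] at h1 ⊢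
      have h3 := abs_le.1 (abs_sub_round (x / (2 : ℝ) ^ e))
      constructor
      · have : ((-2 ^ p - 1 : ℤ) : ℝ) < (round (x / (2 : ℝ) ^ e) : ℤ) := by
          push_cast; linarith [h3.2]
        have := Int.cast_lt.1 this
        omega
      · have : ((round (x / (2 : ℝ) ^ e) : ℤ) : ℝ) < ((2 ^ p + 1 : ℤ) : ℝ) := by
          push_cast; linarith [h3.1]
        have := Int.cast_lt.1 this
        omega
    exact_mod_cast h2
  refine (h.abs_sub_le _ hz).trans ?_
  have : x - (round (x / 2 ^ e) : ℤ) * (2 : ℝ) ^ e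
      = (x / 2 ^ e - (round (x / 2 ^ e) : ℤ)) * 2 ^ e := by
    field_simp
  rw [this, abs_mul, abs_of_pos he, zpow_sub_one₀ two_ne_zero, mul_comm, ← one_div]
  gcongr
  exact abs_sub_round _

theorem abs_sub_le_mul (h : IsNearest p x y) (hp : 1 ≤ p) :
    |x - y| ≤ (2 : ℝ) ^ (-(p : ℤ)) * |x| := by
  rcases eq_or_ne x 0 with rfl | h0
  · simpa using h.abs_sub_le 0 (isFlt_zero p)
  obtain ⟨n, h1, h2⟩ := exists_mem_Ico_zpow (abs_pos.2 h0) (one_lt_two (α := ℝ))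
  have h3 : |x - y| ≤ (2 : ℝ) ^ ((n + 1 - p : ℤ) - 1) :=
    h.abs_sub_le_half hp (h2.le.trans_eq (by congr 1; ring))
  calc |x - y| ≤ (2 : ℝ) ^ (-(p : ℤ)) * 2 ^ n := by
        rw [← zpow_add₀ two_ne_zero]
        exact h3.trans_eq (by congr 1; ring)
    _ ≤ _ := by gcongr

theorem two_zpow_le (h : IsNearest p x y) (hp : 1 ≤ p) (hx : (2 : ℝ) ^ e ≤ |x|) :
    (2 : ℝ) ^ e ≤ |y| := by
  by_contra! hy
  have h1 := abs_sub_abs_le_abs_sub x y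
  rcases abs_choice x with h' | h'
  · have h2 := h.abs_sub_le _ (isFlt_two_zpow hp e)
    rw [h'] at hx h1
    rw [abs_of_nonneg (sub_nonneg.2 hx)] at h2
    linarith
  · have h2 := h.abs_sub_le _ (isFlt_two_zpow hp e).neg
    rw [h'] at hx h1
    rw [abs_of_nonpos (by linarith : x - -2 ^ e ≤ 0)] at h2
    linarith

/-- Either `x` is itself representable, or `y` is so large that its `p` bits end on the coarser grid
`e + 1`. -/
theorem onGrid (h : IsNearest p x y) (hp : 1 ≤ p) (hx : OnGrid e x) : OnGrid e y := by
  rcases le_or_gt |x| ((2 : ℝ) ^ (p + e)) with h' | h'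
  · rwa [h.eq_of_onGrid hp hx h']
  · exact (h.isFlt.onGrid (e := e + 1)
      (by simpa [← add_assoc] using h.two_zpow_le hp h'.le)).mono (by omega)

theorem eq_of_abs_lt (h : IsNearest p x y) (hp : 1 ≤ p) (hx : OnGrid e x)
    (hy : |y| < (2 : ℝ) ^ (p + e)) : y = x := by
  refine h.eq_of_onGrid hp hx (le_of_not_gt fun h' => ?_)
  exact absurd (h.two_zpow_le hp h'.le) (not_le.2 hy)

theorem abs_sub_add_le_left (h : IsNearest p (a + b) x) (ha : IsFlt p a) : |a + b - x| ≤ |b| := by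
  simpa using h.abs_sub_le a ha

theorem abs_sub_add_le_right (h : IsNearest p (a + b) x) (hb : IsFlt p b) :
    |a + b - x| ≤ |a| := by
  simpa using h.abs_sub_le b hb

end IsNearest

theorem two_zpow_add_one_add (p : ℕ) (e : ℤ) : (2 : ℝ) ^ (p + (e + 1)) = 2 * 2 ^ (p + e) := by
  rw [← add_assoc, zpow_add_one₀ two_ne_zero, mul_comm]

theorem IsFlt.onGrid_succ (hx : IsFlt p x) (h : (2 : ℝ) ^ (p + e) ≤ |x|) : OnGrid (e + 1) x :=
  hx.onGrid (by simpa [← add_assoc] using h)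

/-- The round-off error of an addition is a floating point number. -/
theorem IsNearest.isFlt_add_sub (hp : 1 ≤ p) (ha : IsFlt p a) (hb : IsFlt p b)
    (h : IsNearest p (a + b) x) : IsFlt p (a + b - x) := by
  rcases le_total |a| |b| with hab | hab
  · obtain ⟨e, h1, h2, h3⟩ := ha.exists_common_grid hb hab
    exact ⟨e, (h1.add h2).sub (h.onGrid hp (h1.add h2)),
      (h.abs_sub_add_le_right hb).trans_lt h3⟩
  · obtain ⟨e, h1, h2, h3⟩ := hb.exists_common_grid ha hab
    exact ⟨e, (h2.add h1).sub (h.onGrid hp (h2.add h1)),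
      (h.abs_sub_add_le_left ha).trans_lt h3⟩

/-- If `|b| ≤ |a|` then subtracting `a` from the rounded sum `a + b` is exact. -/
theorem IsNearest.isFlt_sub_larger (hp : 1 ≤ p) (ha : IsFlt p a) (hb : IsFlt p b)
    (hab : |b| ≤ |a|) (h : IsNearest p (a + b) x) : IsFlt p (x - a) := by
  obtain ⟨e, h1, h2, h3⟩ := hb.exists_common_grid ha hab
  have hx := h.onGrid hp (h2.add h1)
  have hε := h.abs_sub_add_le_left ha
  have heq : x - a = b - (a + b - x) := by ring
  rcases lt_or_ge |a| ((2 : ℝ) ^ (p + e)) with ha' | ha'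
  -- The possible error `2 ^ e` is exactly compensated by `|b| ≤ 2 ^ (p + e) - 2 ^ e`.
  · refine (hx.sub h2).isFlt hp ?_
    have h4 : |a + b - x| ≤ (2 : ℝ) ^ (e + 1 - 1) := by
      refine h.abs_sub_le_half hp ?_
      rw [two_zpow_add_one_add]
      linarith [abs_add_le a b]
    rw [add_sub_cancel_right] at h4
    have h5 := h1.abs_le_sub_one_zpow h3
    rw [heq]
    linarith [abs_sub b (a + b - x)]
  · rcases lt_or_ge |x| ((2 : ℝ) ^ (p + e)) with hx' | hx'
    · rw [h.eq_of_abs_lt hp (h2.add h1) hx']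
      simpa using hb
    -- Both numbers lie on the grid `e + 1`, and their difference is at most `2|b|`.
    · refine ((h.isFlt.onGrid_succ hx').sub (ha.onGrid_succ ha')).isFlt hp ?_
      rw [two_zpow_add_one_add, heq]
      linarith [abs_sub b (a + b - x)]

/-- Knuth's `TwoSum` is error-free, whatever the tie-breaking rule. -/
theorem twoSum_exact {S z w v y σ : ℝ} (hp : 1 ≤ p) (ha : IsFlt p a) (hb : IsFlt p b)
    (hS : IsNearest p (a + b) S) (hz : IsNearest p (S - a) z) (hw : IsNearest p (S - z) w)
    (hv : IsNearest p (a - w) v) (hy : IsNearest p (b - z) y) (hσ : IsNearest p (v + y) σ) :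
    S + σ = a + b := by
  have herr := hS.isFlt_add_sub hp ha hb
  -- If `S ⊖ a` is exact, then `z = S - a`, `w = a`, `v = 0`, and `b - z` is the round-off error
  -- itself. What remains is the case where `z` is rounded.
  have exact_case : IsFlt p (S - a) → S + σ = a + b := fun h => by
    have hz' := hz.eq_of_isFlt h
    have hw' : w = a := by
      rw [hw.eq_of_isFlt (by rw [hz']; simpa using ha), hz']; ring
    have hv' : v = 0 := by
      rw [hv.eq_of_isFlt (by rw [hw', sub_self]; exact isFlt_zero p), hw', sub_self]
    have hbz : b - z = a + b - S := by rw [hz']; ring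
    have hy' : y = a + b - S := by rw [hy.eq_of_isFlt (by rwa [hbz]), hbz]
    have : σ = a + b - S := by
      rw [hσ.eq_of_isFlt (by rw [hv', zero_add, hy']; exact herr), hv', zero_add, hy']
    rw [this]; ring
  rcases le_total |b| |a| with hab | hab
  · exact exact_case (hS.isFlt_sub_larger hp ha hb hab)
  obtain ⟨e, h1, h2, h3⟩ := ha.exists_common_grid hb hab
  have hSg := hS.onGrid hp (h1.add h2)
  rcases lt_or_ge |S| |a| with hSa | hSa
  · have := hS.eq_of_abs_lt hp (h1.add h2) (hSa.trans h3)
    exact exact_case (by rw [this]; simpa using hb)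
  rcases lt_or_ge |z| ((2 : ℝ) ^ (p + e)) with hz' | hz'
  · have := hz.eq_of_abs_lt hp (hSg.sub h1) hz'
    exact exact_case (this ▸ hz.isFlt)
  have hSz : IsFlt p (S - z) := by
    have h := IsNearest.isFlt_sub_larger hp hS.isFlt ha.neg (by rwa [abs_neg])
      (by rwa [← sub_eq_add_neg])
    simpa using h.neg
  have hw' := hw.eq_of_isFlt hSz
  have hv' : v = a - w := by
    refine hv.eq_of_isFlt ?_
    have h := IsNearest.isFlt_add_sub hp hS.isFlt ha.neg (x := z) (by rwa [← sub_eq_add_neg])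
    rw [hw']
    convert h.neg using 1
    ring
  have hε := hS.abs_sub_add_le_right hb
  -- `b` is a competitor of `z` in rounding `S - a`, and its distance from `S - a` is the error of
  -- the first sum.
  have hδ : |S - a - z| ≤ |a + b - S| := by
    refine (hz.abs_sub_le b hb).trans_eq ?_
    rw [← abs_neg]; congr 1; ring
  have hbz : |b - z| ≤ 2 * |a + b - S| := by
    rw [show b - z = (a + b - S) + (S - a - z) by ring]
    linarith [abs_add_le (a + b - S) (S - a - z)]
  have hy' : y = b - z := by
    refine hy.eq_of_isFlt ?_
    rcases lt_or_ge |b| ((2 : ℝ) ^ (p + e)) with hb' | hb'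
    · refine (h2.sub (hz.onGrid hp (hSg.sub h1))).isFlt hp (hbz.trans ?_)
      have h4 : |a + b - S| ≤ (2 : ℝ) ^ (e + 1 - 1) := by
        refine hS.abs_sub_le_half hp ?_
        rw [two_zpow_add_one_add]
        linarith [abs_add_le a b]
      rw [add_sub_cancel_right] at h4
      have h5 : (2 : ℝ) ^ (e + 1) ≤ 2 ^ (p + e) := zpow_le_zpow_right₀ one_le_two (by omega)
      rw [zpow_add_one₀ two_ne_zero] at h5
      linarith
    · refine ((hb.onGrid_succ hb').sub (hz.isFlt.onGrid_succ hz')).isFlt hp (hbz.trans ?_)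
      rw [two_zpow_add_one_add]
      linarith
  have hsum : v + y = a + b - S := by rw [hv', hy', hw']; ring
  rw [hσ.eq_of_isFlt (by rwa [hsum]), hsum]; ring

end UnboundedFloat

/-! ### Veltkamp's splitting and exactness of `TwoProd` -/

section Dekker

variable {p : ℕ} {a b : ℝ}

/-- What Veltkamp's splitting of `a` into `h + l` achieves. -/
structure IsSplitting (p r : ℕ) (e : ℤ) (a h l : ℝ) : Prop where
  onGrid : OnGrid e a
  abs_lt : |a| < (2 : ℝ) ^ p * 2 ^ e
  normalized : a = 0 ∨ (2 : ℝ) ^ p / 2 * 2 ^ e ≤ |a|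
  onGrid_high : OnGrid (e + r) h
  abs_high_le : |h| ≤ (2 : ℝ) ^ p * 2 ^ e
  low_eq : l = a - h
  abs_low_le : |l| ≤ (2 : ℝ) ^ r / 2 * 2 ^ e

theorem two_zpow_natCast_add (p : ℕ) (e : ℤ) : (2 : ℝ) ^ ((p : ℤ) + e) = 2 ^ p * 2 ^ e := by
  rw [zpow_add₀ two_ne_zero, zpow_natCast]

theorem two_zpow_natCast_add_sub_one (p : ℕ) (e : ℤ) :
    (2 : ℝ) ^ ((p : ℤ) + e - 1) = 2 ^ p / 2 * 2 ^ e := by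
  rw [zpow_sub_one₀ two_ne_zero, two_zpow_natCast_add]
  ring

/-- With `a` normalized on the grid `e`, both `z` and `d` are large enough to lie on the grid `r +
e`. Their difference `h` is therefore computed exactly and lies there too. Moreover `a - h` is minus
the rounding error of `z - a`, which is at most half a unit of that grid. -/
theorem exists_isSplitting {r : ℕ} {z d h l : ℝ} (hr : 1 ≤ r) (hrp : r + 1 ≤ p) (ha : IsFlt p a)
    (hz : IsNearest p (a * (2 ^ r + 1)) z) (hd : IsNearest p (z - a) d)
    (hh : IsNearest p (z - d) h) (hl : IsNearest p (a - h) l) :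
    ∃ e : ℤ, IsSplitting p r e a h l := by
  have hp : 1 ≤ p := by omega
  rcases eq_or_ne a 0 with rfl | h0
  · have h0 := isFlt_zero p
    have hz' : z = 0 := by simpa using hz.eq_of_isFlt (by simpa using h0)
    have hd' : d = 0 := by simpa [hz'] using hd.eq_of_isFlt (by simpa [hz'] using h0)
    have hh' : h = 0 := by simpa [hz', hd'] using hh.eq_of_isFlt (by simpa [hz', hd'] using h0)
    have hl' : l = 0 := by simpa [hh'] using hl.eq_of_isFlt (by simpa [hh'] using h0)
    rw [hh', hl']
    exact ⟨0, .zero _, by rw [abs_zero]; positivity, .inl rfl, .zero _,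
      by rw [abs_zero]; positivity, by simp, by rw [abs_zero]; positivity⟩
  obtain ⟨e, hg, hlo, hup⟩ := ha.exists_normalized h0
  have hup' := hg.abs_le_sub_one_zpow hup
  have hUpos : (0 : ℝ) < 2 ^ e := by positivity
  have hR2 : (2 : ℝ) ≤ 2 ^ r := by simpa using pow_le_pow_right₀ (one_le_two (α := ℝ)) hr
  have hRp : (2 : ℝ) * 2 ^ r ≤ 2 ^ p := by
    rw [← pow_succ']; exact pow_le_pow_right₀ one_le_two hrp
  have hHg : OnGrid e ((2 : ℝ) ^ ((p : ℤ) + e - 1)) := (OnGrid.two_zpow _).mono (by omega)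
  have e1 (k : ℤ) : (2 : ℝ) ^ ((r : ℤ) + k) = 2 ^ r * 2 ^ k := two_zpow_natCast_add r k
  have e2 : (2 : ℝ) ^ ((p : ℤ) + (r + e)) = 2 ^ r * (2 ^ p * 2 ^ e) := by
    rw [two_zpow_natCast_add, two_zpow_natCast_add]; ring
  have e3 : (2 : ℝ) ^ ((p : ℤ) + (r + e) - 1) = 2 ^ r * (2 ^ p / 2 * 2 ^ e) := by
    rw [two_zpow_natCast_add_sub_one, two_zpow_natCast_add]; ring
  have e4 : (2 : ℝ) ^ ((p : ℤ) + (r + e + 1)) = 2 * (2 ^ r * (2 ^ p * 2 ^ e)) := by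
    rw [← e2, ← add_assoc, zpow_add_one₀ two_ne_zero]; ring
  have e5 : (2 : ℝ) ^ ((r : ℤ) + e - 1) = 2 ^ r / 2 * 2 ^ e := two_zpow_natCast_add_sub_one r e
  have hUH : (2 : ℝ) ^ e * 2 * 2 ^ r ≤ 2 ^ p * 2 ^ e := by nlinarith
  rw [two_zpow_natCast_add_sub_one] at hlo hHg
  rw [two_zpow_natCast_add] at hup hup'
  have hmul : |a * (2 ^ r + 1)| = |a| * 2 ^ r + |a| := by
    rw [abs_mul, abs_of_pos (by positivity : (0 : ℝ) < 2 ^ r + 1)]; ring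
  have hε₁ : |a * (2 ^ r + 1) - z| ≤ 2 ^ r * 2 ^ e := by
    have := hz.abs_sub_le_half (e := r + e + 1) hp (by
      rw [e4, hmul]
      nlinarith [abs_nonneg a])
    rwa [add_sub_cancel_right, e1] at this
  have hzg : OnGrid (r + e) z := by
    refine hz.isFlt.onGrid (hz.two_zpow_le hp ?_)
    rw [e3, hmul]
    nlinarith [abs_nonneg a]
  have hza : 2 ^ r * (2 ^ p / 2 * 2 ^ e) ≤ |z - a| := by
    rcases le_or_gt (2 ^ p / 2 * 2 ^ e + 2 ^ e) |a| with h1 | h1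
    · have h2 : a * 2 ^ r = (z - a) + (a * (2 ^ r + 1) - z) := by ring
      have h3 := abs_add_le (z - a) (a * (2 ^ r + 1) - z)
      rw [← h2, abs_mul, abs_of_pos (by positivity : (0 : ℝ) < 2 ^ r)] at h3
      nlinarith
    -- At the lower end of the binade the general estimate fails, but there `|a|` is a power of two
    -- and the first product is exact.
    · have h2 : |a| = 2 ^ p / 2 * 2 ^ e := (hg.abs.le_of_lt_add hHg h1).antisymm hlo
      have h3 : z = a * (2 ^ r + 1) := by
        have hR : OnGrid 0 ((2 : ℝ) ^ r + 1) := ⟨2 ^ r + 1, by push_cast; ring⟩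
        have ha' : OnGrid (p + e - 1) a := by
          have h4 : OnGrid (p + e - 1) |a| := by
            rw [h2, ← two_zpow_natCast_add_sub_one]; exact .two_zpow _
          rcases abs_choice a with h5 | h5
          · rwa [h5] at h4
          · rw [h5] at h4; simpa using h4.neg
        refine hz.eq_of_onGrid hp (ha'.mul hR) ?_
        rw [hmul, h2, add_zero, two_zpow_natCast_add, two_zpow_natCast_add_sub_one]
        have : (0 : ℝ) < 2 ^ p / 2 * 2 ^ e := by positivity
        nlinarith
      rw [h3, show a * (2 ^ r + 1) - a = a * 2 ^ r by ring, abs_mul,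
        abs_of_pos (by positivity : (0 : ℝ) < 2 ^ r), h2]
      exact le_of_eq (by ring)
  have hza' : |z - a| ≤ 2 ^ r * (2 ^ p * 2 ^ e) := by
    have h2 : z - a = a * 2 ^ r - (a * (2 ^ r + 1) - z) := by ring
    have h3 := abs_sub (a * 2 ^ r) (a * (2 ^ r + 1) - z)
    rw [← h2, abs_mul, abs_of_pos (by positivity : (0 : ℝ) < 2 ^ r)] at h3
    nlinarith
  have hdg : OnGrid (r + e) d := hd.isFlt.onGrid (hd.two_zpow_le hp (by rwa [e3]))
  have hε₂ : |z - a - d| ≤ 2 ^ r / 2 * 2 ^ e := by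
    have := hd.abs_sub_le_half (e := r + e) hp (by rwa [e2])
    rwa [e5] at this
  have hzd : |z - d| ≤ |a| + 2 ^ r / 2 * 2 ^ e := by
    have := abs_add_le a (z - a - d)
    rw [show a + (z - a - d) = z - d by ring] at this
    linarith
  have hhe : h = z - d := by
    refine hh.eq_of_onGrid hp (hzg.sub hdg) (hzd.trans ?_)
    rw [e2]
    have : (0 : ℝ) < 2 ^ p * 2 ^ e := by positivity
    nlinarith
  have hhg : OnGrid (r + e) h := by rw [hhe]; exact hzg.sub hdg
  have hah : |a - h| ≤ 2 ^ r / 2 * 2 ^ e := by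
    rwa [hhe, ← abs_neg, show -(a - (z - d)) = z - a - d by ring]
  have hle : l = a - h := by
    refine hl.eq_of_onGrid hp (hg.sub (hhg.mono (by omega))) (hah.trans ?_)
    rw [two_zpow_natCast_add]
    nlinarith
  refine ⟨e, hg, hup, .inr hlo, by rwa [add_comm], ?_, hle, by rwa [hle]⟩
  refine hhg.abs.le_of_lt_add ?_ ?_
  · rw [← two_zpow_natCast_add]
    exact (OnGrid.two_zpow _).mono (by omega)
  · rw [hhe, e1]
    have : (0 : ℝ) < 2 ^ r * 2 ^ e := by positivity
    linarith

/-- Dekker's `TwoProd` is error-free, whatever the tie-breaking rule. -/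
theorem twoProd_exact {r : ℕ} {e f : ℤ} {P ah al bh bl hh t₁ lh t₂ hl t₃ ll π : ℝ}
    (hrp : r + 2 ≤ p) (hr : p ≤ 2 * r) (hr' : 2 * r ≤ p + 1)
    (ha : IsSplitting p r e a ah al) (hb : IsSplitting p r f b bh bl)
    (hP : IsNearest p (a * b) P) (h_hh : IsNearest p (ah * bh) hh)
    (ht₁ : IsNearest p (P - hh) t₁) (h_lh : IsNearest p (al * bh) lh)
    (ht₂ : IsNearest p (t₁ - lh) t₂) (h_hl : IsNearest p (ah * bl) hl)
    (ht₃ : IsNearest p (t₂ - hl) t₃) (h_ll : IsNearest p (al * bl) ll)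
    (hπ : IsNearest p (ll - t₃) π) : P + π = a * b := by
  have hp : 1 ≤ p := by omega
  have hW : (0 : ℝ) < 2 ^ (e + f) := by positivity
  have hWe : (2 : ℝ) ^ (e + f) = 2 ^ e * 2 ^ f := zpow_add₀ two_ne_zero _ _
  have hR1 : (1 : ℝ) ≤ 2 ^ r := one_le_pow₀ one_le_two
  have hRp : (4 : ℝ) * 2 ^ r ≤ 2 ^ p := by
    calc (4 : ℝ) * 2 ^ r = 2 ^ (r + 2) := by ring
      _ ≤ 2 ^ p := pow_le_pow_right₀ one_le_two hrp
  have hRR : (2 : ℝ) ^ p ≤ 2 ^ r * 2 ^ r := by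
    rw [← pow_add]; exact pow_le_pow_right₀ one_le_two (by omega)
  have hRR' : (2 : ℝ) ^ r * 2 ^ r ≤ 2 * 2 ^ p := by
    rw [← pow_add, ← pow_succ']; exact pow_le_pow_right₀ one_le_two (by omega)
  have hag : OnGrid e al := by
    rw [ha.low_eq]; exact ha.onGrid.sub (ha.onGrid_high.mono (by omega))
  have hbg : OnGrid f bl := by
    rw [hb.low_eq]; exact hb.onGrid.sub (hb.onGrid_high.mono (by omega))
  have bound {x y X Y : ℝ} (hx : |x| ≤ X * 2 ^ e) (hy : |y| ≤ Y * 2 ^ f) :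
      |x * y| ≤ X * Y * 2 ^ (e + f) := by
    rw [abs_mul, hWe]
    calc |x| * |y| ≤ (X * 2 ^ e) * (Y * 2 ^ f) :=
          mul_le_mul hx hy (abs_nonneg _) ((abs_nonneg _).trans hx)
      _ = _ := by ring
  -- All sizes are measured in the unit `2 ^ (e + f)`: an operation is exact if its result is a
  -- multiple of `2 ^ k` units and at most `2 ^ p * 2 ^ k` units.
  have exact {g : ℤ} {x y : ℝ} {k : ℕ} (h : IsNearest p x y) (hx : OnGrid g x)
      (hg : g = k + (e + f)) (hx' : |x| ≤ 2 ^ p * 2 ^ k * 2 ^ (e + f)) : y = x := by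
    subst hg
    refine h.eq_of_onGrid hp hx (hx'.trans_eq ?_)
    rw [two_zpow_natCast_add, two_zpow_natCast_add]; ring
  have hε : |a * b - P| ≤ 2 ^ p / 2 * 2 ^ (e + f) := by
    have := hP.abs_sub_le_half (e := p + (e + f)) hp (by
      refine (bound ha.abs_lt.le hb.abs_lt.le).trans_eq ?_
      rw [two_zpow_natCast_add, two_zpow_natCast_add]; ring)
    rwa [two_zpow_natCast_add_sub_one] at this
  have hPg : OnGrid (p - 1 + (e + f)) P := by
    rcases ha.normalized with h | h
    · rw [hP.eq_of_isFlt (by rw [h, zero_mul]; exact isFlt_zero p), h, zero_mul]; exact .zero _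
    rcases hb.normalized with h' | h'
    · rw [hP.eq_of_isFlt (by rw [h', mul_zero]; exact isFlt_zero p), h', mul_zero]; exact .zero _
    refine hP.isFlt.onGrid (hP.two_zpow_le hp ?_)
    rw [abs_mul]
    refine le_trans (le_of_eq ?_) (mul_le_mul h h' (by positivity) (abs_nonneg _))
    rw [show (p : ℤ) + (p - 1 + (e + f)) - 1 = p + (p + (e + f)) - 1 - 1 by ring,
      zpow_sub_one₀ two_ne_zero, two_zpow_natCast_add_sub_one, two_zpow_natCast_add, hWe]
    ring
  have b_ll : |al * bl| ≤ 2 ^ r / 2 * (2 ^ r / 2) * 2 ^ (e + f) := bound ha.abs_low_le hb.abs_low_le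
  have b_lh : |al * bh| ≤ 2 ^ r / 2 * 2 ^ p * 2 ^ (e + f) := bound ha.abs_low_le hb.abs_high_le
  have b_l : |a * bl| ≤ 2 ^ p * (2 ^ r / 2) * 2 ^ (e + f) := bound ha.abs_lt.le hb.abs_low_le
  have b_hl : |ah * bl| ≤ 2 ^ p * (2 ^ r / 2) * 2 ^ (e + f) := bound ha.abs_high_le hb.abs_low_le
  have e_hh : hh = ah * bh := by
    refine exact (k := 2 * r) h_hh (ha.onGrid_high.mul hb.onGrid_high) (by push_cast; ring)
      ((bound ha.abs_high_le hb.abs_high_le).trans ?_)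
    rw [two_mul r, pow_add]
    gcongr
  have e_lh : lh = al * bh := by
    refine exact (k := r) h_lh (hag.mul hb.onGrid_high) (by ring) (b_lh.trans ?_)
    gcongr ?_ * _
    nlinarith
  have e_hl : hl = ah * bl := by
    refine exact (k := r) h_hl (ha.onGrid_high.mul hbg) (by ring) (b_hl.trans ?_)
    gcongr ?_ * _
    nlinarith
  have e_ll : ll = al * bl := by
    refine exact (k := 0) h_ll (hag.mul hbg) (by simp) (b_ll.trans ?_)
    gcongr ?_ * _
    nlinarith
  -- Each subtraction removes one partial product: the successive differences become smaller while
  -- their grids become finer, so that each still fits into `p` bits.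
  have d₁ : P - hh = a * bl + al * bh - (a * b - P) := by
    rw [e_hh, ha.low_eq, hb.low_eq]; ring
  have g₁ : OnGrid (p - 1 + (e + f)) (P - hh) := by
    rw [e_hh]
    exact hPg.sub ((ha.onGrid_high.mul hb.onGrid_high).mono (by omega))
  have e₁ : t₁ = P - hh := by
    refine exact (k := p - 1) ht₁ g₁ (by omega) ?_
    have h2 : (2 : ℝ) ^ (p - 1) = 2 ^ p / 2 := by
      rw [eq_div_iff two_ne_zero, ← pow_succ]; congr 1; omega
    rw [d₁, h2]
    refine (abs_sub _ _).trans ((add_le_add ((abs_add_le _ _).trans (add_le_add b_l b_lh)) hε).trans ?_)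
    rw [← add_mul, ← add_mul]
    gcongr ?_ * _
    nlinarith
  have d₂ : t₁ - lh = a * bl - (a * b - P) := by rw [e₁, e_lh, d₁]; ring
  have g₂ : OnGrid (r + (e + f)) (t₁ - lh) := by
    rw [e₁, e_lh]
    exact (g₁.mono (by omega)).sub ((hag.mul hb.onGrid_high).mono (by omega))
  have e₂ : t₂ = t₁ - lh := by
    refine exact (k := r) ht₂ g₂ rfl ?_
    rw [d₂]
    refine (abs_sub _ _).trans ((add_le_add b_l hε).trans ?_)
    rw [← add_mul]
    gcongr ?_ * _
    nlinarith
  have d₃ : t₂ - hl = al * bl - (a * b - P) := by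
    rw [e₂, e_hl, d₂, ha.low_eq]; ring
  have g₃ : OnGrid (e + f) (t₂ - hl) := by
    rw [e₂, e_hl]
    exact (g₂.mono (by omega)).sub ((ha.onGrid_high.mul hbg).mono (by omega))
  -- Here `2 * r ≤ p + 1` gives `|al * bl| ≤ 2 ^ (p - 1)` units, and the error of `P` has the same
  -- bound, which just suffices.
  have e₃ : t₃ = t₂ - hl := by
    refine exact (k := 0) ht₃ g₃ (by simp) ?_
    rw [d₃]
    refine (abs_sub _ _).trans ((add_le_add b_ll hε).trans ?_)
    rw [← add_mul]
    gcongr ?_ * _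
    linarith
  have d₄ : ll - t₃ = a * b - P := by rw [e₃, e_ll, d₃]; ring
  have g₄ : OnGrid (e + f) (ll - t₃) := by
    rw [e₃, e_ll]
    exact (hag.mul hbg).sub g₃
  have e₄ : π = ll - t₃ := by
    refine exact (k := 0) hπ g₄ (by simp) ?_
    rw [d₄]
    refine hε.trans ?_
    gcongr ?_ * _
    have : (0 : ℝ) < 2 ^ p := by positivity
    linarith
  rw [e₄, d₄]; ring

end Dekker

/-! ### From absence of underflow to the model with unbounded exponents -/

theorem IsFloat.isFlt {p : ℕ} {emin : ℤ} {x : ℝ} (h : IsFloat p emin x) : IsFlt p x := by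
  obtain ⟨m, e, h1, -, rfl⟩ := h
  refine ⟨e, ⟨m, rfl⟩, ?_⟩
  rw [two_zpow_natCast_add, abs_mul, abs_of_pos (by positivity : (0 : ℝ) < 2 ^ e)]
  gcongr
  exact_mod_cast h1

namespace FloatRun

variable {α β : Type} (x : FloatRun α) (f : α → FloatRun β)

theorem val_bind : (x >>= f).val = (f x.val).val := rfl

theorem noUnderflow_bind :
    (x >>= f).noUnderflow ↔ x.noUnderflow ∧ (f x.val).noUnderflow := Iff.rfl

theorem val_pure (a : α) : (pure a : FloatRun α).val = a := rfl

theorem noUnderflow_pure (a : α) : (pure a : FloatRun α).noUnderflow ↔ True := Iff.rfl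

end FloatRun

namespace FloatArith

variable {A : FloatArith} {x a b : ℝ}

theorem unitRoundoff_pos (A : FloatArith) : 0 < A.unitRoundoff := by
  unfold unitRoundoff; positivity

/-- If `fl x ≠ x`, absence of underflow puts `|x|` at or above the smallest normal number. A
competitor with exponent below `emin` is no larger in modulus than that number, so the normal number
with the sign of `x` is at least as close to `x`. -/
theorem isNearest_fl (hp : 1 ≤ A.prec) (h : ¬ A.Underflows x) :
    IsNearest A.prec x (A.fl x) := by
  refine ⟨(A.fl_isFloat x).isFlt, fun z hz => ?_⟩
  by_cases hx : A.fl x = x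
  · rw [hx, sub_self, abs_zero]; positivity
  have hxn : (2 : ℝ) ^ (A.emin + A.prec - 1) ≤ |x| := by
    by_contra! h'
    exact h ⟨h', hx⟩
  obtain ⟨e, ⟨m, hm⟩, hlt⟩ := hz
  have hpow : (1 : ℤ) ≤ 2 ^ (A.prec - 1) := one_le_pow₀ (by norm_num)
  have hpow' : (2 : ℤ) ^ A.prec = 2 * 2 ^ (A.prec - 1) := by
    rw [← pow_succ']; congr 1; omega
  have hw : (2 : ℝ) ^ (A.emin + A.prec - 1) = ((2 ^ (A.prec - 1) : ℤ) : ℝ) * 2 ^ A.emin := by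
    push_cast
    rw [← two_zpow_natCast_add]
    congr 1; omega
  rcases le_or_gt A.emin e with he | he
  · refine A.fl_nearest x z ⟨m, e, ?_, he, hm⟩
    rw [hm, abs_mul, abs_of_pos (by positivity : (0 : ℝ) < 2 ^ e), two_zpow_natCast_add] at hlt
    exact_mod_cast lt_of_mul_lt_mul_right hlt (by positivity)
  have hz' : |z| ≤ (2 : ℝ) ^ (A.emin + A.prec - 1) :=
    hlt.le.trans (zpow_le_zpow_right₀ one_le_two (by omega))
  have h1 := abs_sub_abs_le_abs_sub x z
  rcases abs_choice x with h' | h'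
  · refine (A.fl_nearest x (2 ^ (A.emin + A.prec - 1))
      ⟨2 ^ (A.prec - 1), A.emin, ?_, le_rfl, hw⟩).trans ?_
    · rw [abs_of_pos (by positivity)]; omega
    · rw [h'] at hxn h1
      rw [abs_of_nonneg (sub_nonneg.2 hxn)]
      linarith
  · refine (A.fl_nearest x (-2 ^ (A.emin + A.prec - 1))
      ⟨-2 ^ (A.prec - 1), A.emin, ?_, le_rfl, by rw [hw]; push_cast; ring⟩).trans ?_
    · rw [abs_neg, abs_of_pos (by positivity)]; omega
    · rw [h'] at hxn h1
      rw [abs_of_nonpos (by linarith)]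
      linarith

/-- `q` is a pair of floating point numbers, the rounded value of `x` and its round-off error. -/
structure IsErrorFree (A : FloatArith) (x : ℝ) (q : ℝ × ℝ) : Prop where
  isFlt_fst : IsFlt A.prec q.1
  isFlt_snd : IsFlt A.prec q.2
  add_eq : q.1 + q.2 = x
  abs_snd_le : |q.2| ≤ A.unitRoundoff * |x|

theorem IsErrorFree.abs_fst_le {q : ℝ × ℝ} (h : A.IsErrorFree x q) :
    |q.1| ≤ (1 + A.unitRoundoff) * |x| := by
  have h1 := h.abs_snd_le
  have h2 := abs_sub x q.2
  rw [← h.add_eq, add_sub_cancel_right, h.add_eq] at h2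
  linarith

theorem isErrorFree_of_isNearest (hp : 1 ≤ A.prec) {q : ℝ × ℝ} (h : IsNearest A.prec x q.1)
    (h2 : IsFlt A.prec q.2) (h3 : q.1 + q.2 = x) : A.IsErrorFree x q := by
  refine ⟨h.isFlt, h2, h3, ?_⟩
  have := h.abs_sub_le_mul hp
  rwa [show x - q.1 = q.2 by rw [← h3]; ring] at this

theorem abs_sub_round_le (hp : 1 ≤ A.prec) (h : (A.round x).noUnderflow) :
    |x - (A.round x).val| ≤ A.unitRoundoff * |x| :=
  (isNearest_fl hp h).abs_sub_le_mul hp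

theorem abs_round_le (hp : 1 ≤ A.prec) (h : (A.round x).noUnderflow) :
    |(A.round x).val| ≤ (1 + A.unitRoundoff) * |x| := by
  have h1 := abs_sub_round_le hp h
  have h2 := abs_sub x (x - (A.round x).val)
  rw [sub_sub_cancel] at h2
  linarith

theorem isFlt_round (x : ℝ) : IsFlt A.prec (A.round x).val := (A.fl_isFloat x).isFlt

theorem isErrorFree_twoSum (hp : 1 ≤ A.prec) (ha : IsFlt A.prec a) (hb : IsFlt A.prec b)
    (h : (A.twoSum a b).noUnderflow) : A.IsErrorFree (a + b) (A.twoSum a b).val := by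
  simp only [twoSum, add, sub, round, FloatRun.noUnderflow_bind, FloatRun.val_bind,
    FloatRun.val_pure, FloatRun.noUnderflow_pure] at h ⊢
  obtain ⟨h1, h2, h3, h4, h5, h6, -⟩ := h
  exact isErrorFree_of_isNearest hp (isNearest_fl hp h1) (A.fl_isFloat _).isFlt <|
    twoSum_exact hp ha hb (isNearest_fl hp h1) (isNearest_fl hp h2) (isNearest_fl hp h3)
      (isNearest_fl hp h4) (isNearest_fl hp h5) (isNearest_fl hp h6)

theorem exists_isSplitting_split (hp : 4 ≤ A.prec) (ha : IsFlt A.prec a)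
    (h : (A.split a).noUnderflow) :
    ∃ e, IsSplitting A.prec ((A.prec + 1) / 2) e a (A.split a).val.1 (A.split a).val.2 := by
  have hp1 : 1 ≤ A.prec := by omega
  simp only [split, mul, sub, round, FloatRun.noUnderflow_bind, FloatRun.val_bind,
    FloatRun.val_pure, FloatRun.noUnderflow_pure] at h ⊢
  obtain ⟨h1, h2, h3, h4, -⟩ := h
  exact exists_isSplitting (by omega) (by omega) ha (isNearest_fl hp1 h1) (isNearest_fl hp1 h2)
    (isNearest_fl hp1 h3) (isNearest_fl hp1 h4)

theorem isErrorFree_twoProd (hp : 4 ≤ A.prec) (ha : IsFlt A.prec a) (hb : IsFlt A.prec b)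
    (h : (A.twoProd a b).noUnderflow) : A.IsErrorFree (a * b) (A.twoProd a b).val := by
  have hp1 : 1 ≤ A.prec := by omega
  simp only [twoProd, mul, sub, round, FloatRun.noUnderflow_bind, FloatRun.val_bind,
    FloatRun.val_pure, FloatRun.noUnderflow_pure] at h ⊢
  obtain ⟨h0, hsa, hsb, h1, h2, h3, h4, h5, h6, h7, h8, -⟩ := h
  obtain ⟨e, he⟩ := exists_isSplitting_split hp ha hsa
  obtain ⟨f, hf⟩ := exists_isSplitting_split hp hb hsb
  exact isErrorFree_of_isNearest hp1 (isNearest_fl hp1 h0) (A.fl_isFloat _).isFlt <|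
    twoProd_exact (by omega) (by omega) (by omega) he hf (isNearest_fl hp1 h0)
      (isNearest_fl hp1 h1) (isNearest_fl hp1 h2) (isNearest_fl hp1 h3) (isNearest_fl hp1 h4)
      (isNearest_fl hp1 h5) (isNearest_fl hp1 h6) (isNearest_fl hp1 h7) (isNearest_fl hp1 h8)

end FloatArith

/-! ### Summation: ordinary, error-free, and in `K`-fold precision -/

/-- The sum of the absolute values of the elements of a list. -/
def absSum (l : List ℝ) : ℝ := (l.map abs).sum

theorem absSum_nil : absSum [] = 0 := rfl

theorem absSum_cons (x : ℝ) (l : List ℝ) : absSum (x :: l) = |x| + absSum l := by simp [absSum]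

theorem absSum_append (l l' : List ℝ) : absSum (l ++ l') = absSum l + absSum l' := by
  simp [absSum]

theorem absSum_nonneg (l : List ℝ) : 0 ≤ absSum l := by
  induction l with
  | nil => exact le_rfl
  | cons x l ih => rw [absSum_cons]; positivity

theorem abs_sum_le_absSum (l : List ℝ) : |l.sum| ≤ absSum l := by
  induction l with
  | nil => simp [absSum_nil]
  | cons x l ih =>
    rw [absSum_cons, List.sum_cons]
    linarith [abs_add_le x l.sum]

theorem absSum_dropLast_le (l : List ℝ) : absSum l.dropLast ≤ absSum l := by
  rcases List.eq_nil_or_concat l with rfl | ⟨l, x, rfl⟩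
  · exact le_rfl
  · rw [List.concat_eq_append, List.dropLast_concat, absSum_append]
    linarith [absSum_nonneg [x]]

/-- The last entry is the sum minus the others. In `SumK` the last entry carries the result, and
this trades its modulus for that of the sum. -/
theorem absSum_le_abs_sum_add (l : List ℝ) : absSum l ≤ |l.sum| + 2 * absSum l.dropLast := by
  rcases List.eq_nil_or_concat l with rfl | ⟨l, x, rfl⟩
  · simp [absSum_nil]
  · rw [List.concat_eq_append, List.dropLast_concat, absSum_append, absSum_cons, absSum_nil,
      List.sum_append, List.sum_singleton]
    have h1 := abs_sub (l.sum + x) l.sum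
    rw [add_sub_cancel_left] at h1
    linarith [abs_sum_le_absSum l]

namespace FloatArith

variable {A : FloatArith}

/-- `η` are the errors of adding up numbers with the sum `t` and the sum of moduli `E` in `L`
operations with the result `l`. -/
structure IsSumEFT (A : FloatArith) (L : ℕ) (t E : ℝ) (l : ℝ) (η : List ℝ) : Prop where
  isFlt : IsFlt A.prec l
  isFlt_errs : ∀ x ∈ η, IsFlt A.prec x
  length_eq : η.length = L
  add_eq : l + η.sum = t
  abs_le : |l| ≤ (1 + A.unitRoundoff) ^ L * E
  absSum_le : absSum η ≤ L * A.unitRoundoff * (1 + A.unitRoundoff) ^ L * E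

theorem isSumEFT_sumFromEFT (hp : 1 ≤ A.prec) (xs : List ℝ) (acc : ℝ) (h0 : IsFlt A.prec acc)
    (hx : ∀ x ∈ xs, IsFlt A.prec x) (h : (A.sumFromEFT acc xs).noUnderflow) :
    A.IsSumEFT xs.length (acc + xs.sum) (|acc| + absSum xs) (A.sumFromEFT acc xs).val.1
      (A.sumFromEFT acc xs).val.2 := by
  have hu := A.unitRoundoff_pos
  induction xs generalizing acc with
  | nil =>
    simp only [sumFromEFT, FloatRun.val_pure]
    exact ⟨h0, by simp, rfl, by simp, by simp [absSum_nil], by simp [absSum_nil]⟩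
  | cons x xs ih =>
    simp only [sumFromEFT, FloatRun.noUnderflow_bind, FloatRun.val_bind,
      FloatRun.val_pure, FloatRun.noUnderflow_pure] at h ⊢
    have hS := isErrorFree_twoSum hp h0 (hx x (by simp)) h.1
    have hS1 := hS.abs_fst_le
    set q := (A.twoSum acc x).val
    have H := ih q.1 hS.isFlt_fst (fun y hy => hx y (by simp [hy])) h.2.1
    set u := A.unitRoundoff
    have hE := absSum_nonneg xs
    have hax := abs_add_le acc x
    have hS2 := hS.abs_snd_le
    have key : |q.1| + absSum xs ≤ (1 + u) * (|acc| + (|x| + absSum xs)) := by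
      nlinarith
    have hg : (1 : ℝ) ≤ (1 + u) ^ (xs.length + 1) := one_le_pow₀ (by linarith)
    have hpos : 0 ≤ |acc| + (|x| + absSum xs) := by positivity
    refine ⟨H.isFlt, ?_, by simp [H.length_eq], ?_, ?_, ?_⟩
    · intro y hy
      rcases List.mem_cons.1 hy with rfl | hy
      exacts [hS.isFlt_snd, H.isFlt_errs y hy]
    · simp only [List.sum_cons]
      linarith [H.add_eq, hS.add_eq]
    · rw [absSum_cons, List.length_cons, pow_succ, mul_assoc]
      exact H.abs_le.trans (by gcongr)
    · rw [absSum_cons, absSum_cons, List.length_cons]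
      calc |q.2| + absSum (A.sumFromEFT q.1 xs).val.2
          ≤ u * (|acc| + (|x| + absSum xs)) + xs.length * u * (1 + u) ^ xs.length *
            ((1 + u) * (|acc| + (|x| + absSum xs))) := by
              refine add_le_add (hS2.trans ?_) (H.absSum_le.trans ?_)
              · gcongr; linarith
              · gcongr
        _ = u * 1 * (|acc| + (|x| + absSum xs)) + xs.length * u * (1 + u) ^ (xs.length + 1) *
            (|acc| + (|x| + absSum xs)) := by ring
        _ ≤ u * (1 + u) ^ (xs.length + 1) * (|acc| + (|x| + absSum xs)) +
            xs.length * u * (1 + u) ^ (xs.length + 1) * (|acc| + (|x| + absSum xs)) := by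
              gcongr
        _ = _ := by push_cast; ring

/-- What is needed of the summation of numbers with the sum `t` and the sum of moduli `E` in `L`
operations. -/
structure IsRoundedSum (A : FloatArith) (L : ℕ) (t E : ℝ) (l : ℝ) : Prop where
  abs_le : |l| ≤ (1 + A.unitRoundoff) ^ L * E
  abs_sub_le : |t - l| ≤ L * A.unitRoundoff * (1 + A.unitRoundoff) ^ L * E

theorem isRoundedSum_sumFrom (hp : 1 ≤ A.prec) (xs : List ℝ) (acc : ℝ)
    (h : (A.sumFrom acc xs).noUnderflow) :
    A.IsRoundedSum xs.length (acc + xs.sum) (|acc| + absSum xs) (A.sumFrom acc xs).val := by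
  have hu := A.unitRoundoff_pos
  induction xs generalizing acc with
  | nil =>
    simp only [sumFrom, FloatRun.val_pure]
    exact ⟨by simp [absSum_nil], by simp [absSum_nil]⟩
  | cons x xs ih =>
    simp only [sumFrom, add, FloatRun.noUnderflow_bind, FloatRun.val_bind] at h ⊢
    have hS1 := abs_round_le hp h.1
    have hS2 := abs_sub_round_le hp h.1
    have H := ih _ h.2
    set q := (A.round (acc + x)).val
    set u := A.unitRoundoff
    have hE := absSum_nonneg xs
    have hax := abs_add_le acc x
    have key : |q| + absSum xs ≤ (1 + u) * (|acc| + (|x| + absSum xs)) := by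
      nlinarith
    have hg : (1 : ℝ) ≤ (1 + u) ^ (xs.length + 1) := one_le_pow₀ (by linarith)
    have hpos : 0 ≤ |acc| + (|x| + absSum xs) := by positivity
    refine ⟨?_, ?_⟩
    · rw [absSum_cons, List.length_cons, pow_succ, mul_assoc]
      exact H.abs_le.trans (by gcongr)
    · rw [absSum_cons, List.length_cons, List.sum_cons]
      calc |acc + (x + xs.sum) - (A.sumFrom q xs).val|
          ≤ |acc + x - q| + |q + xs.sum - (A.sumFrom q xs).val| := by
              refine le_trans (le_of_eq ?_) (abs_add_le _ _)
              congr 1; ring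
        _ ≤ u * (|acc| + (|x| + absSum xs)) + xs.length * u * (1 + u) ^ xs.length *
            ((1 + u) * (|acc| + (|x| + absSum xs))) := by
              refine add_le_add (hS2.trans ?_) (H.abs_sub_le.trans ?_)
              · gcongr; linarith
              · gcongr
        _ = u * 1 * (|acc| + (|x| + absSum xs)) + xs.length * u * (1 + u) ^ (xs.length + 1) *
            (|acc| + (|x| + absSum xs)) := by ring
        _ ≤ u * (1 + u) ^ (xs.length + 1) * (|acc| + (|x| + absSum xs)) +
            xs.length * u * (1 + u) ^ (xs.length + 1) * (|acc| + (|x| + absSum xs)) := by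
              gcongr
        _ = _ := by push_cast; ring

theorem IsSumEFT.mono {L M : ℕ} {t E l : ℝ} {η : List ℝ} (hE : 0 ≤ E) (hLM : L ≤ M)
    (h : A.IsSumEFT L t E l η) :
    |l| ≤ (1 + A.unitRoundoff) ^ M * E ∧
      absSum η ≤ M * A.unitRoundoff * (1 + A.unitRoundoff) ^ M * E := by
  have hu := A.unitRoundoff_pos
  have h1 : (1 + A.unitRoundoff) ^ L ≤ (1 + A.unitRoundoff) ^ M :=
    pow_le_pow_right₀ (by linarith) hLM
  exact ⟨h.abs_le.trans (by gcongr), h.absSum_le.trans (by gcongr)⟩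

theorem IsRoundedSum.mono {L M : ℕ} {t E l : ℝ} (hE : 0 ≤ E) (hLM : L ≤ M)
    (h : A.IsRoundedSum L t E l) :
    |l| ≤ (1 + A.unitRoundoff) ^ M * E ∧
      |t - l| ≤ M * A.unitRoundoff * (1 + A.unitRoundoff) ^ M * E := by
  have hu := A.unitRoundoff_pos
  have h1 : (1 + A.unitRoundoff) ^ L ≤ (1 + A.unitRoundoff) ^ M :=
    pow_le_pow_right₀ (by linarith) hLM
  exact ⟨h.abs_le.trans (by gcongr), h.abs_sub_le.trans (by gcongr)⟩

theorem isSumEFT_sumEFT (hp : 1 ≤ A.prec) (e : List ℝ) (he : ∀ x ∈ e, IsFlt A.prec x)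
    (h : (A.sumEFT e).noUnderflow) :
    A.IsSumEFT (e.length - 1) e.sum (absSum e) (A.sumEFT e).val.1 (A.sumEFT e).val.2 := by
  cases e with
  | nil =>
    simp only [sumEFT, FloatRun.val_pure]
    exact ⟨isFlt_zero _, by simp, rfl, by simp, by simp [absSum_nil], by simp [absSum_nil]⟩
  | cons x xs =>
    rw [List.sum_cons, absSum_cons]
    exact isSumEFT_sumFromEFT hp xs x (he x (by simp)) (fun y hy => he y (by simp [hy])) h

theorem isRoundedSum_sum (hp : 1 ≤ A.prec) (e : List ℝ) (h : (A.sum e).noUnderflow) :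
    A.IsRoundedSum (e.length - 1) e.sum (absSum e) (A.sum e).val := by
  cases e with
  | nil =>
    simp only [sum, FloatRun.val_pure]
    exact ⟨by simp [absSum_nil], by simp [absSum_nil]⟩
  | cons x xs =>
    rw [List.sum_cons, absSum_cons]
    exact isRoundedSum_sumFrom hp xs x h

/-- One pass of `VecSum`. -/
structure IsVecSum (A : FloatArith) (L : ℕ) (t E : ℝ) (w : List ℝ) : Prop where
  isFlt : ∀ x ∈ w, IsFlt A.prec x
  length_eq : w.length = L + 1
  sum_eq : w.sum = t
  absSum_dropLast_le : absSum w.dropLast ≤ L * A.unitRoundoff * (1 + A.unitRoundoff) ^ L * E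

theorem isVecSum_vecSumFrom (hp : 1 ≤ A.prec) (xs : List ℝ) (c : ℝ) (h0 : IsFlt A.prec c)
    (hx : ∀ x ∈ xs, IsFlt A.prec x) (h : (A.vecSumFrom c xs).noUnderflow) :
    A.IsVecSum xs.length (c + xs.sum) (|c| + absSum xs) (A.vecSumFrom c xs).val := by
  have hu := A.unitRoundoff_pos
  induction xs generalizing c with
  | nil =>
    simp only [vecSumFrom, FloatRun.val_pure]
    exact ⟨by simpa using h0, rfl, by simp, by simp [absSum_nil]⟩
  | cons x xs ih =>
    simp only [vecSumFrom, FloatRun.noUnderflow_bind, FloatRun.val_bind,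
      FloatRun.val_pure, FloatRun.noUnderflow_pure] at h ⊢
    have hS := isErrorFree_twoSum hp (hx x (by simp)) h0 h.1
    have hS1 := hS.abs_fst_le
    set q := (A.twoSum x c).val
    have H := ih q.1 hS.isFlt_fst (fun y hy => hx y (by simp [hy])) h.2.1
    set u := A.unitRoundoff
    have hE := absSum_nonneg xs
    have hax := abs_add_le x c
    have hS2 := hS.abs_snd_le
    have key : |q.1| + absSum xs ≤ (1 + u) * (|c| + (|x| + absSum xs)) := by
      nlinarith
    have hg : (1 : ℝ) ≤ (1 + u) ^ (xs.length + 1) := one_le_pow₀ (by linarith)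
    have hpos : 0 ≤ |c| + (|x| + absSum xs) := by positivity
    refine ⟨?_, by simp [H.length_eq], ?_, ?_⟩
    · intro y hy
      rcases List.mem_cons.1 hy with rfl | hy
      exacts [hS.isFlt_snd, H.isFlt y hy]
    · simp only [List.sum_cons]
      linarith [H.sum_eq, hS.add_eq]
    · have hne : (A.vecSumFrom q.1 xs).val ≠ [] := by
        intro h'
        have := H.length_eq
        simp [h'] at this
      rw [absSum_cons, List.length_cons, List.dropLast_cons_of_ne_nil hne, absSum_cons]
      calc |q.2| + absSum (A.vecSumFrom q.1 xs).val.dropLast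
          ≤ u * (|c| + (|x| + absSum xs)) + xs.length * u * (1 + u) ^ xs.length *
            ((1 + u) * (|c| + (|x| + absSum xs))) := by
              refine add_le_add (hS2.trans ?_) (H.absSum_dropLast_le.trans ?_)
              · gcongr; linarith
              · gcongr
        _ = u * 1 * (|c| + (|x| + absSum xs)) + xs.length * u * (1 + u) ^ (xs.length + 1) *
            (|c| + (|x| + absSum xs)) := by ring
        _ ≤ u * (1 + u) ^ (xs.length + 1) * (|c| + (|x| + absSum xs)) +
            xs.length * u * (1 + u) ^ (xs.length + 1) * (|c| + (|x| + absSum xs)) := by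
              gcongr
        _ = _ := by push_cast; ring

/-- Only the last addition involves the last entry, and its error is `u` times nearly the full sum.
All other errors are controlled by the entries before the last. This keeps the coefficient of `|∑|`
equal to `u`. -/
theorem abs_sumFrom_sub_le (hp : 1 ≤ A.prec) (hu1 : A.unitRoundoff ≤ 1) (xs : List ℝ) (acc : ℝ)
    (h : (A.sumFrom acc xs).noUnderflow) :
    |(A.sumFrom acc xs).val - (acc + xs.sum)| ≤ A.unitRoundoff * |acc + xs.sum| +
      2 * 3 ^ xs.length * A.unitRoundoff * absSum (acc :: xs).dropLast := by
  have hu := A.unitRoundoff_pos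
  induction xs generalizing acc with
  | nil =>
    simp only [sumFrom, FloatRun.val_pure]
    simp [absSum_nil]
    positivity
  | cons x xs ih =>
    simp only [sumFrom, add, FloatRun.noUnderflow_bind, FloatRun.val_bind] at h ⊢
    have hS1 := abs_round_le hp h.1
    have hS2 := abs_sub_round_le hp h.1
    have H := ih _ h.2
    set q := (A.round (acc + x)).val
    set u := A.unitRoundoff
    rcases xs with _ | ⟨y, ys⟩
    · simp only [sumFrom, FloatRun.val_pure]
      rw [abs_sub_comm, List.sum_singleton]
      have : 0 ≤ absSum [acc, x].dropLast := absSum_nonneg _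
      refine hS2.trans (le_add_of_nonneg_right (by positivity))
    · rw [List.dropLast_cons_of_ne_nil (by simp), absSum_cons] at H
      rw [List.dropLast_cons_of_ne_nil (by simp), List.dropLast_cons_of_ne_nil (by simp),
        absSum_cons, absSum_cons, List.sum_cons, List.length_cons (a := x)]
      set t := (y :: ys).sum
      set B := absSum (y :: ys).dropLast
      set L := (y :: ys).length
      set R := (A.sumFrom q (y :: ys)).val
      have hB : 0 ≤ B := absSum_nonneg _
      have hax := abs_add_le acc x
      have h1 : |R - (acc + (x + t))| ≤ |R - (q + t)| + |acc + x - q| := by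
        rw [abs_sub_comm (acc + x) q]
        refine le_trans (le_of_eq ?_) (abs_add_le _ _)
        congr 1; ring
      have h2 : |q + t| ≤ |acc + (x + t)| + |acc + x - q| := by
        rw [abs_sub_comm (acc + x) q]
        refine le_trans (le_of_eq ?_) (abs_add_le _ _)
        congr 1; ring
      have h3 : |acc + x - q| ≤ u * (|acc| + (|x| + B)) :=
        hS2.trans (by gcongr; linarith)
      have h4 : |q| + B ≤ 2 * (|acc| + (|x| + B)) := by
        have : |q| ≤ 2 * |acc + x| := hS1.trans (by gcongr; linarith)
        linarith
      have hb : 0 ≤ |acc| + (|x| + B) := by positivity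
      generalize |acc| + (|x| + B) = b at *
      have h5 : u * |q + t| ≤ u * |acc + (x + t)| + u * b := by
        rw [← mul_add]
        gcongr
        refine h2.trans ?_
        gcongr
        exact h3.trans (mul_le_of_le_one_left hb hu1)
      have h6 : 2 * 3 ^ L * u * (|q| + B) ≤ 2 * 3 ^ L * u * (2 * b) := by gcongr
      -- With this, `2 + 4 * 3 ^ L ≤ 2 * 3 ^ (L + 1)`, which is where the base 3 comes from.
      have h7 : 1 * (u * b) ≤ 3 ^ L * (u * b) := by
        gcongr
        exact one_le_pow₀ (by norm_num)
      rw [pow_succ]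
      linarith

/-- A pass of `VecSum` keeps the sum and leaves only round-off errors in front of the last entry. So
the part in front shrinks by a factor `O(u)`, up to `O(u)|∑|`, whose contribution is of second
order. -/
theorem exists_sumAfterPasses_bound (L m : ℕ) : ∃ C : ℝ, 0 ≤ C ∧
    ∀ (A : FloatArith) (v : List ℝ), 1 ≤ A.prec → A.unitRoundoff ≤ 1 → v.length = L + 1 →
      (∀ x ∈ v, IsFlt A.prec x) → (A.sumAfterPasses m v).noUnderflow →
      |(A.sumAfterPasses m v).val - v.sum| ≤ (A.unitRoundoff + C * A.unitRoundoff ^ 2) * |v.sum| +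
        C * A.unitRoundoff ^ (m + 1) * absSum v.dropLast := by
  induction m with
  | zero =>
    refine ⟨2 * 3 ^ L, by positivity, fun A v hp hu1 hL hv h => ?_⟩
    have hu := A.unitRoundoff_pos
    rcases v with _ | ⟨x, xs⟩
    · simp at hL
    simp only [sumAfterPasses, sum] at h ⊢
    have := abs_sumFrom_sub_le hp hu1 xs x h
    rw [List.length_cons, add_left_inj] at hL
    rw [hL] at this
    rw [List.sum_cons, zero_add, pow_one]
    refine this.trans ?_
    gcongr
    exact le_add_of_nonneg_right (by positivity)
  | succ m ih =>
    obtain ⟨C, hC, ih⟩ := ih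
    set c : ℝ := L * 2 ^ L
    refine ⟨C + 2 * (C * c), by positivity, fun A v hp hu1 hL hv h => ?_⟩
    have hu := A.unitRoundoff_pos
    rcases v with _ | ⟨x, xs⟩
    · simp at hL
    simp only [sumAfterPasses, vecSum, FloatRun.noUnderflow_bind, FloatRun.val_bind] at h ⊢
    have H := isVecSum_vecSumFrom hp xs x (hv x (by simp)) (fun y hy => hv y (by simp [hy])) h.1
    rw [List.length_cons, add_left_inj] at hL
    have H' := ih A _ hp hu1 (by rw [H.length_eq, hL]) H.isFlt h.2
    rw [H.sum_eq, ← List.sum_cons] at H'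
    have hB := H.absSum_dropLast_le
    rw [← absSum_cons, hL] at hB
    set u := A.unitRoundoff
    set w := (A.vecSumFrom x xs).val
    set v := x :: xs
    have h1 : absSum w.dropLast ≤ c * u * (|v.sum| + 2 * absSum v.dropLast) := by
      refine hB.trans ?_
      calc L * u * (1 + u) ^ L * absSum v
          ≤ L * u * 2 ^ L * (|v.sum| + 2 * absSum v.dropLast) := by
            gcongr
            · exact absSum_nonneg v
            · linarith
            · exact absSum_le_abs_sum_add v
        _ = _ := by ring
    have h2 : u ^ (m + 1) * u ≤ u ^ 2 := by
      rw [← pow_succ]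
      exact pow_le_pow_of_le_one hu.le hu1 (by omega)
    calc _ ≤ _ := H'
      _ ≤ (u + C * u ^ 2) * |v.sum| +
          C * u ^ (m + 1) * (c * u * (|v.sum| + 2 * absSum v.dropLast)) := by gcongr
      _ = (u + C * u ^ 2) * |v.sum| + C * c * (u ^ (m + 1) * u) * |v.sum| +
          2 * (C * c) * u ^ (m + 1 + 1) * absSum v.dropLast := by ring
      _ ≤ (u + C * u ^ 2) * |v.sum| + 2 * (C * c) * u ^ 2 * |v.sum| +
          (C + 2 * (C * c)) * u ^ (m + 1 + 1) * absSum v.dropLast := by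
            have hB0 := absSum_nonneg v.dropLast
            have hc : 0 ≤ C * c := by positivity
            have h3 : C * c * (u ^ (m + 1) * u) ≤ 2 * (C * c) * u ^ 2 := by
              linarith [mul_le_mul_of_nonneg_left h2 hc, mul_nonneg hc (sq_nonneg u)]
            have h4 : 2 * (C * c) ≤ C + 2 * (C * c) := by linarith
            gcongr
      _ = _ := by ring

end FloatArith

/-! ### The error groups at one node -/

/-- Bounds for the computed value `d` and the round-off errors of one error group, in terms of the
bounds for its ingredients. -/
theorem errorGroup_bound {u s r x y l P l' P₁ S₂ P₃ d E D η π σ π₁ σ₂ π₃ σ₄ : ℝ} {M : ℕ}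
    (hu : 0 ≤ u) (hE : 0 ≤ E) (hD : 0 ≤ D) (hs : 0 ≤ s) (hs1 : s ≤ 1)
    (hr : |r| ≤ (1 + u) * (1 - s)) (hl : |l| ≤ (1 + u) ^ M * E)
    (hη : η ≤ M * u * (1 + u) ^ M * E) (hP : |P| ≤ (1 + u) * D) (hπ : |π| ≤ u * D)
    (hl' : |l'| ≤ (1 + u) * |l + P|) (hσ : |σ| ≤ u * |l + P|)
    (hP₁ : |P₁| ≤ (1 + u) * |s * y|) (hπ₁ : |π₁| ≤ u * |s * y|)
    (hS₂ : |S₂| ≤ (1 + u) * |l' + P₁|) (hσ₂ : |σ₂| ≤ u * |l' + P₁|)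
    (hP₃ : |P₃| ≤ (1 + u) * |r * x|) (hπ₃ : |π₃| ≤ u * |r * x|)
    (hd : |d| ≤ (1 + u) * |S₂ + P₃|) (hσ₄ : |σ₄| ≤ u * |S₂ + P₃|) :
    |d| ≤ (1 + u) ^ (M + 4) * (E + D + (s * |y| + (1 - s) * |x|)) ∧
    η + |π| + |σ| + |π₁| + |σ₂| + |π₃| + |σ₄| + u * ((1 - s) * |x|) ≤
      u * (1 + u) ^ (M + 4) * ((M + 4) * (E + D) + 3 * (s * |y| + (1 - s) * |x|)) := by
  have hg : 1 ≤ 1 + u := by linarith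
  have hmono {i j : ℕ} (h : i ≤ j) : (1 + u) ^ i ≤ (1 + u) ^ j := pow_le_pow_right₀ hg h
  have hsy : |s * y| = s * |y| := by rw [abs_mul, abs_of_nonneg hs]
  have hrx : |r * x| ≤ (1 + u) * ((1 - s) * |x|) := by
    rw [abs_mul, ← mul_assoc]; gcongr
  have ha : 0 ≤ s * |y| := by positivity
  have hc : 0 ≤ (1 - s) * |x| := mul_nonneg (by linarith) (abs_nonneg _)
  rw [hsy] at hP₁ hπ₁
  generalize s * |y| = a at *
  generalize (1 - s) * |x| = c at *
  have b₁ : |l + P| ≤ (1 + u) ^ (M + 1) * (E + D) := by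
    calc |l + P| ≤ (1 + u) ^ M * E + (1 + u) ^ 1 * D := by
          rw [pow_one]; linarith [abs_add_le l P]
      _ ≤ (1 + u) ^ (M + 1) * E + (1 + u) ^ (M + 1) * D := by
          gcongr ?_ * _ + ?_ * _ <;> exact hmono (by omega)
      _ = _ := by ring
  have b₂ : |l' + P₁| ≤ (1 + u) ^ (M + 2) * (E + D + a) := by
    calc |l' + P₁| ≤ (1 + u) * ((1 + u) ^ (M + 1) * (E + D)) + (1 + u) ^ 1 * a := by
          rw [pow_one]
          refine (abs_add_le l' P₁).trans (add_le_add (hl'.trans ?_) hP₁)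
          gcongr
      _ ≤ (1 + u) * ((1 + u) ^ (M + 1) * (E + D)) + (1 + u) ^ (M + 2) * a := by
          gcongr _ + ?_ * _; exact hmono (by omega)
      _ = _ := by ring
  have b₃ : |S₂ + P₃| ≤ (1 + u) ^ (M + 3) * (E + D + (a + c)) := by
    calc |S₂ + P₃| ≤ (1 + u) * ((1 + u) ^ (M + 2) * (E + D + a)) + (1 + u) ^ 2 * c := by
          refine (abs_add_le S₂ P₃).trans (add_le_add (hS₂.trans ?_) (hP₃.trans ?_))
          · gcongr
          · rw [sq, mul_assoc]; gcongr
      _ ≤ (1 + u) * ((1 + u) ^ (M + 2) * (E + D + a)) + (1 + u) ^ (M + 3) * c := by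
          gcongr _ + ?_ * _; exact hmono (by omega)
      _ = _ := by ring
  refine ⟨hd.trans ?_, ?_⟩
  · rw [pow_succ', mul_assoc]; gcongr
  have up {i : ℕ} {t w : ℝ} (h : |t| ≤ (1 + u) ^ i * w) (hi : i ≤ M + 4) (hw : 0 ≤ w) :
      u * |t| ≤ u * (1 + u) ^ (M + 4) * w := by
    rw [mul_assoc]
    gcongr
    exact h.trans (by gcongr ?_ * _; exact hmono hi)
  have e₁ := up b₁ (by omega) (by positivity)
  have e₂ := up b₂ (by omega) (by positivity)
  have e₃ := up b₃ (by omega) (by positivity)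
  have e₄ := up (i := 1) (by rwa [pow_one]) (by omega) hc
  have e₅ : u * a ≤ u * (1 + u) ^ (M + 4) * a := by
    gcongr; exact le_mul_of_one_le_right hu (one_le_pow₀ hg)
  have e₆ : u * c ≤ u * (1 + u) ^ (M + 4) * c := by
    gcongr; exact le_mul_of_one_le_right hu (one_le_pow₀ hg)
  have e₇ : u * D ≤ u * (1 + u) ^ (M + 4) * D := by
    gcongr; exact le_mul_of_one_le_right hu (one_le_pow₀ hg)
  have e₈ : M * u * (1 + u) ^ M * E ≤ M * (u * (1 + u) ^ (M + 4) * E) := by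
    rw [mul_assoc, mul_assoc (M : ℝ), ← mul_assoc u]
    gcongr ?_ * (_ * ?_ * _)
    exact hmono (by omega)
  have e₉ : 0 ≤ u * (1 + u) ^ (M + 4) * E := by positivity
  have e₁₀ : 0 ≤ (M : ℝ) * (u * (1 + u) ^ (M + 4) * D) := by positivity
  -- Counting: `s|y|` enters `π₁, σ₂, σ₄` and `(1-s)|x|` enters `π₃, σ₄` and the rounding of `r`,
  -- three times each. `E` enters `η` with weight `M` and then `σ, σ₂, σ₄`; `D` enters four errors.
  linarith

namespace FloatArith

variable {A : FloatArith}

/-- `r` is the rounded value of `1 - s`, and `ρ` its round-off error. -/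
structure IsWeight (A : FloatArith) (s r ρ : ℝ) : Prop where
  nonneg : 0 ≤ s
  le_one : s ≤ 1
  isFlt : IsFlt A.prec s
  isFlt_fst : IsFlt A.prec r
  isFlt_snd : IsFlt A.prec ρ
  add_eq : r + ρ = 1 - s
  abs_fst_le : |r| ≤ (1 + A.unitRoundoff) * (1 - s)
  abs_snd_le : |ρ| ≤ A.unitRoundoff * (1 - s)

/-- The outcome of the inner loop over error groups: the computed errors `ds` add up to the exact
value up to the remainder `R'`. -/
structure IsErrorGroups (A : FloatArith) (s T R : ℝ) (G : ℝ) (q X : ℕ → ℝ) (zs : List (ℝ × ℝ))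
    (ds : List ℝ) : Prop where
  length_eq : ds.length = zs.length
  isFlt : ∀ d ∈ ds, IsFlt A.prec d
  abs_le : ∀ i (hi : i < ds.length), |ds[i]| ≤ G * (q i + X i) * T
  exists_remainder : ∃ R', |R'| ≤ q zs.length * T ∧
    ds.sum = R + s * (zs.map Prod.snd).sum + (1 - s) * (zs.map Prod.fst).sum - R'

/-- Induction over the groups: the errors of one group are the input of the next, so the identities
telescope and only the losses of the last group remain. `q i` bounds the local input of the `i`-th
group, `X i` the errors accumulated in earlier rounds. With no group at all, the whole local error
is the remainder. -/
theorem isErrorGroups_errorGroups {M : ℕ} {s r ρ Tx Ty : ℝ} (hp : 4 ≤ A.prec)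
    (hw : A.IsWeight s r ρ) (zs : List (ℝ × ℝ)) (e : List ℝ) (δb : ℝ) (q X : ℕ → ℝ)
    (hlen : e.length + 6 * zs.length ≤ M)
    (he : ∀ x ∈ e, IsFlt A.prec x) (hδ : IsFlt A.prec δb)
    (hz : ∀ z ∈ zs, IsFlt A.prec z.1 ∧ IsFlt A.prec z.2)
    (hX : ∀ i (hi : i < zs.length), |zs[i].1| ≤ X i * Tx ∧ |zs[i].2| ≤ X i * Ty)
    (hT : 0 ≤ (1 - s) * Tx + s * Ty)
    (hq0 : absSum e + |ρ * δb| ≤ q 0 * ((1 - s) * Tx + s * Ty))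
    (hq : ∀ i, A.unitRoundoff * (1 + A.unitRoundoff) ^ (M + 4) * ((M + 4) * q i + 3 * X i) ≤
      q (i + 1))
    (h : (A.errorGroups s r ρ e δb zs).noUnderflow) :
    A.IsErrorGroups s ((1 - s) * Tx + s * Ty) (e.sum + ρ * δb) ((1 + A.unitRoundoff) ^ (M + 4))
      q X zs (A.errorGroups s r ρ e δb zs).val := by
  have hp1 : 1 ≤ A.prec := by omega
  have hu := A.unitRoundoff_pos
  set T := (1 - s) * Tx + s * Ty with hTdef
  induction zs generalizing e δb q X with
  | nil =>
    simp only [errorGroups, FloatRun.val_pure]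
    refine ⟨rfl, by simp, by simp, e.sum + ρ * δb, ?_, by simp⟩
    exact (abs_add_le _ _).trans (le_trans (by gcongr; exact abs_sum_le_absSum e) hq0)
  | cons z zs ih =>
    obtain ⟨x, y⟩ := z
    have hxy := hz (x, y) (by simp)
    have hX0 := hX 0 (by simp)
    simp only [List.getElem_cons_zero] at hX0 hxy
    have hE := absSum_nonneg e
    have hD := abs_nonneg (ρ * δb)
    have hs1 := hw.le_one
    have hW : s * |y| + (1 - s) * |x| ≤ X 0 * T := by
      have h1 := mul_le_mul_of_nonneg_left hX0.1 (by linarith : 0 ≤ 1 - s)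
      have h2 := mul_le_mul_of_nonneg_left hX0.2 hw.nonneg
      rw [hTdef]
      linarith
    have hρx : |ρ * x| ≤ A.unitRoundoff * ((1 - s) * |x|) := by
      rw [abs_mul, ← mul_assoc]
      gcongr
      exact hw.abs_snd_le
    have value_le {d : ℝ} (hd : |d| ≤ (1 + A.unitRoundoff) ^ (M + 4) *
        (absSum e + |ρ * δb| + (s * |y| + (1 - s) * |x|))) :
        |d| ≤ (1 + A.unitRoundoff) ^ (M + 4) * (q 0 + X 0) * T := by
      refine hd.trans ?_
      rw [mul_assoc]
      gcongr
      linarith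
    have err_le {t : ℝ} (ht : t ≤ A.unitRoundoff * (1 + A.unitRoundoff) ^ (M + 4) *
        ((M + 4) * (absSum e + |ρ * δb|) + 3 * (s * |y| + (1 - s) * |x|))) : t ≤ q 1 * T := by
      refine ht.trans (le_trans ?_ (mul_le_mul_of_nonneg_right (hq 0) hT))
      calc _ ≤ A.unitRoundoff * (1 + A.unitRoundoff) ^ (M + 4) *
            ((M + 4) * (q 0 * T) + 3 * (X 0 * T)) := by gcongr
        _ = _ := by ring
    rcases zs with _ | ⟨z', zs⟩
    · simp only [errorGroups, localError, mul, add, FloatRun.noUnderflow_bind, FloatRun.val_bind,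
        FloatRun.val_pure, FloatRun.noUnderflow_pure] at h ⊢
      obtain ⟨⟨h1, h2, h3⟩, h4, h5, h6, h7, -⟩ := h
      have H := isRoundedSum_sum hp1 e h1
      have Hm := H.mono (M := M) hE (by simp at hlen; omega)
      set l := (A.sum e).val
      have B2 := abs_sub_round_le hp1 h2
      have B2' := abs_round_le hp1 h2
      set P := (A.round (ρ * δb)).val
      have B3 := abs_sub_round_le hp1 h3
      have B3' := abs_round_le hp1 h3
      set l' := (A.round (l + P)).val
      have B4 := abs_sub_round_le hp1 h4
      have B4' := abs_round_le hp1 h4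
      set P₁ := (A.round (s * y)).val
      have B5 := abs_sub_round_le hp1 h5
      have B5' := abs_round_le hp1 h5
      set S₂ := (A.round (l' + P₁)).val
      have B6 := abs_sub_round_le hp1 h6
      have B6' := abs_round_le hp1 h6
      set P₃ := (A.round (r * x)).val
      have B7 := abs_sub_round_le hp1 h7
      have B7' := abs_round_le hp1 h7
      set d := (A.round (S₂ + P₃)).val
      obtain ⟨K1, K2⟩ := errorGroup_bound hu.le hE hD hw.nonneg hw.le_one hw.abs_fst_le Hm.1 Hm.2
        B2' B2 B3' B3 B4' B4 B5' B5 B6' B6 B7' B7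
      -- In the last group the roundings are lost, and so is `ρ * x`, since no later group corrects
      -- `r` to `1 - s`.
      refine ⟨rfl, ?_, ?_, (e.sum - l) + (ρ * δb - P) + (l + P - l') + (s * y - P₁) +
        (l' + P₁ - S₂) + (r * x - P₃) + (S₂ + P₃ - d) + ρ * x, err_le ?_, ?_⟩
      · intro d' hd'
        rw [List.mem_singleton.1 hd']
        exact isFlt_round _
      · intro i hi
        have : i = 0 := by simpa using hi
        subst this
        exact value_le K1
      · refine le_trans ?_ K2
        refine (abs_add_le _ _).trans (add_le_add ?_ hρx)
        refine (abs_add_le _ _).trans (add_le_add ?_ le_rfl)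
        refine (abs_add_le _ _).trans (add_le_add ?_ le_rfl)
        refine (abs_add_le _ _).trans (add_le_add ?_ le_rfl)
        refine (abs_add_le _ _).trans (add_le_add ?_ le_rfl)
        refine (abs_add_le _ _).trans (add_le_add ?_ le_rfl)
        exact abs_add_le _ _
      · simp only [List.map_cons, List.map_nil, List.sum_singleton]
        linear_combination x * hw.add_eq
    · simp only [errorGroups, localErrorEFT, FloatRun.noUnderflow_bind, FloatRun.val_bind,
        FloatRun.val_pure, FloatRun.noUnderflow_pure] at h ⊢
      obtain ⟨⟨h1, h2, h3, -⟩, h4, h5, h6, h7, h8, -⟩ := h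
      have H := isSumEFT_sumEFT hp1 e he h1
      have Hm := H.mono (M := M) hE (by simp at hlen; omega)
      set l := (A.sumEFT e).val.1
      set η := (A.sumEFT e).val.2
      have B2 := isErrorFree_twoProd hp hw.isFlt_snd hδ h2
      set P := (A.twoProd ρ δb).val
      have B3 := isErrorFree_twoSum hp1 H.isFlt B2.isFlt_fst h3
      set l' := (A.twoSum l P.1).val
      have B4 := isErrorFree_twoProd hp hw.isFlt hxy.2 h4
      set P₁ := (A.twoProd s y).val
      have B5 := isErrorFree_twoSum hp1 B3.isFlt_fst B4.isFlt_fst h5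
      set S₂ := (A.twoSum l'.1 P₁.1).val
      have B6 := isErrorFree_twoProd hp hw.isFlt_fst hxy.1 h6
      set P₃ := (A.twoProd r x).val
      have B7 := isErrorFree_twoSum hp1 B5.isFlt_fst B6.isFlt_fst h7
      set d := (A.twoSum S₂.1 P₃.1).val
      obtain ⟨K1, K2⟩ := errorGroup_bound hu.le hE hD hw.nonneg hw.le_one hw.abs_fst_le Hm.1 Hm.2
        B2.abs_fst_le B2.abs_snd_le B3.abs_fst_le B3.abs_snd_le B4.abs_fst_le B4.abs_snd_le
        B5.abs_fst_le B5.abs_snd_le B6.abs_fst_le B6.abs_snd_le B7.abs_fst_le B7.abs_snd_le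
      have habs : absSum (η ++ [P.2, l'.2] ++ [P₁.2, S₂.2, P₃.2, d.2]) =
          absSum η + |P.2| + |l'.2| + |P₁.2| + |S₂.2| + |P₃.2| + |d.2| := by
        simp only [absSum_append, absSum_cons, absSum_nil]
        ring
      -- The list of errors grows by at most six, in accordance with `hlen`; with `δb` replaced by
      -- `x`, the next group accounts for `ρ * x`.
      have I := ih (η ++ [P.2, l'.2] ++ [P₁.2, S₂.2, P₃.2, d.2]) x (fun i => q (i + 1))
        (fun i => X (i + 1))
        (by
          have := H.length_eq
          simp only [List.length_append, List.length_cons, List.length_nil] at hlen ⊢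
          omega)
        (by
          intro t ht
          simp only [List.append_assoc, List.mem_append, List.mem_cons, List.not_mem_nil,
            or_false] at ht
          rcases ht with ht | (rfl | rfl) | rfl | rfl | rfl | rfl
          exacts [H.isFlt_errs t ht, B2.isFlt_snd, B3.isFlt_snd, B4.isFlt_snd, B5.isFlt_snd,
            B6.isFlt_snd, B7.isFlt_snd])
        hxy.1 (fun z hz' => hz z (List.mem_cons_of_mem _ hz'))
        (fun i hi => hX (i + 1) (Nat.succ_lt_succ hi)) (fun i => hq (i + 1)) h8
        (by
          rw [habs]
          exact err_le ((add_le_add le_rfl hρx).trans K2))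
      obtain ⟨R', hR', hsum⟩ := I.exists_remainder
      refine ⟨by rw [List.length_cons, I.length_eq]; rfl, ?_, ?_, R', hR', ?_⟩
      · intro t ht
        rcases List.mem_cons.1 ht with rfl | ht
        exacts [B7.isFlt_fst, I.isFlt t ht]
      · rintro (_ | i) hi
        · exact value_le K1
        · exact I.abs_le i (by simpa using hi)
      · rw [List.sum_cons, hsum]
        simp only [List.sum_append, List.sum_cons, List.sum_nil, List.map_cons]
        linear_combination x * hw.add_eq + H.add_eq + B2.add_eq + B3.add_eq + B4.add_eq +
          B5.add_eq + B6.add_eq + B7.add_eq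

end FloatArith

/-! ### Growth of the error coefficients -/

/-- The coefficients of `u ^ F` in the bounds for the local errors, given those in the bounds for
the accumulated errors. -/
def localCoeff (c : ℝ) (f : ℕ → ℝ) : ℕ → ℝ
  | 0 => 0
  | F + 1 => c * localCoeff c f F + 3 * f F

/-- The coefficients of `u ^ F` in the bounds for the accumulated errors after `m` rounds. -/
def errCoeff (c : ℝ) : ℕ → ℕ → ℝ
  | 0, 0 => 1
  | 0, _ + 1 => 0
  | m + 1, F => errCoeff c m F + localCoeff c (errCoeff c m) F

theorem localCoeff_nonneg {c : ℝ} (hc : 0 ≤ c) {f : ℕ → ℝ} (hf : ∀ F, 0 ≤ f F) (F : ℕ) :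
    0 ≤ localCoeff c f F := by
  induction F with
  | zero => exact le_rfl
  | succ F ih =>
    rw [localCoeff]
    have := hf F
    positivity

theorem errCoeff_nonneg {c : ℝ} (hc : 0 ≤ c) (m F : ℕ) : 0 ≤ errCoeff c m F := by
  induction m generalizing F with
  | zero => cases F <;> simp [errCoeff]
  | succ m ih =>
    rw [errCoeff]
    exact add_nonneg (ih F) (localCoeff_nonneg hc ih F)

theorem errCoeff_zero_right (c : ℝ) (m : ℕ) : errCoeff c m 0 = 1 := by
  induction m with
  | zero => rfl
  | succ m ih => rw [errCoeff, ih, localCoeff, add_zero]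

/-- To leading order the recursion reads `f_{F+1}(m+1) - f_{F+1}(m) = 3 f_F(m)`, solved by `3^F
binom(m, F)`. Local and accumulated coefficients are bounded together. `C` must not depend on `m`,
since it enters `C₂`. -/
theorem exists_errCoeff_le {c : ℝ} (hc : 0 ≤ c) (F : ℕ) : ∃ C : ℝ, 0 ≤ C ∧ ∀ m : ℕ,
    localCoeff c (errCoeff c m) (F + 1) ≤ 3 ^ (F + 1) * m.choose F + C * (m + 1) ^ (F - 1) ∧
    errCoeff c m (F + 1) ≤ 3 ^ (F + 1) * m.choose (F + 1) + C * m ^ F := by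
  induction F with
  | zero =>
    have h1 (m : ℕ) : localCoeff c (errCoeff c m) 1 = 3 := by
      simp [localCoeff, errCoeff_zero_right]
    refine ⟨0, le_rfl, fun m => ⟨by simp [h1], ?_⟩⟩
    induction m with
    | zero => simp [errCoeff]
    | succ m ih =>
      rw [errCoeff, zero_add, h1]
      simp at ih ⊢
      linarith
  | succ F ih =>
    obtain ⟨C, hC, ih⟩ := ih
    set C' : ℝ := c * 3 ^ (F + 1) + c * C + 3 * C with hC'
    have hC'0 : 0 ≤ C' := by positivity
    have hloc (m : ℕ) : localCoeff c (errCoeff c m) (F + 1 + 1) ≤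
        3 ^ (F + 1 + 1) * m.choose (F + 1) + C' * (m + 1) ^ F := by
      obtain ⟨h1, h2⟩ := ih m
      have hm : (1 : ℝ) ≤ m + 1 := by linarith [(Nat.cast_nonneg m : (0 : ℝ) ≤ m)]
      have h3 : (m.choose F : ℝ) ≤ (m + 1) ^ F := by
        calc (m.choose F : ℝ) ≤ (m : ℝ) ^ F := by exact_mod_cast Nat.choose_le_pow m F
          _ ≤ (m + 1) ^ F := by gcongr; linarith
      have h4 : (m + 1 : ℝ) ^ (F - 1) ≤ (m + 1) ^ F := pow_le_pow_right₀ hm (by omega)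
      have h5 : (m : ℝ) ^ F ≤ (m + 1) ^ F := by gcongr; linarith
      rw [localCoeff]
      -- The `c` term is only of order `m ^ F` and goes entirely into the remainder.
      calc _ ≤ c * (3 ^ (F + 1) * (m + 1) ^ F + C * (m + 1) ^ F) +
            3 * (3 ^ (F + 1) * m.choose (F + 1) + C * (m + 1) ^ F) := by
              refine add_le_add (mul_le_mul_of_nonneg_left (h1.trans ?_) hc)
                (mul_le_mul_of_nonneg_left (h2.trans ?_) (by norm_num)) <;> gcongr
        _ = _ := by rw [hC']; ring
    refine ⟨C', hC'0, fun m => ⟨hloc m, ?_⟩⟩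
    induction m with
    | zero => simp [errCoeff]
    | succ m ihm =>
      rw [errCoeff, Nat.choose_succ_succ' m (F + 1)]
      have h1 : (m : ℝ) ^ (F + 1) ≤ m * (m + 1) ^ F := by
        rw [pow_succ']; gcongr; linarith
      have h2 : C' * (m : ℝ) ^ (F + 1) ≤ C' * (m * (m + 1) ^ F) := by gcongr
      push_cast
      calc _ ≤ _ := add_le_add ihm (hloc m)
        _ ≤ 3 ^ (F + 1 + 1) * m.choose (F + 1 + 1) + C' * (m * (m + 1) ^ F) +
            (3 ^ (F + 1 + 1) * m.choose (F + 1) + C' * (m + 1) ^ F) := by gcongr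
        _ = _ := by ring

/-! ### The de Casteljau recursion and the induction over rounds -/

theorem bernsteinEval_succ (m : ℕ) (b : ℕ → ℝ) (s : ℝ) :
    bernsteinEval (m + 1) b s =
      (1 - s) * bernsteinEval m b s + s * bernsteinEval m (fun i => b (i + 1)) s := by
  simp only [bernsteinEval, bernsteinPolynomial, Polynomial.eval_mul, Polynomial.eval_pow,
    Polynomial.eval_natCast, Polynomial.eval_X, Polynomial.eval_sub, Polynomial.eval_one]
  have h1 : ∑ j ∈ Finset.range (m + 1), b j * (m.choose j * s ^ j * (1 - s) ^ (m - j)) =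
      ∑ j ∈ Finset.range (m + 1),
        b (j + 1) * (m.choose (j + 1) * s ^ (j + 1) * (1 - s) ^ (m - (j + 1))) +
        b 0 * (m.choose 0 * s ^ 0 * (1 - s) ^ (m - 0)) := by
    rw [← Finset.sum_range_succ' (fun j => b j * (m.choose j * s ^ j * (1 - s) ^ (m - j))),
      Finset.sum_range_succ _ (m + 1), Nat.choose_succ_self]
    simp
  rw [h1, Finset.sum_range_succ', mul_add, Finset.mul_sum, Finset.mul_sum, add_right_comm,
    ← Finset.sum_add_distrib]
  congr 1
  · refine Finset.sum_congr rfl fun j hj => ?_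
    rw [Nat.choose_succ_succ' m j, Nat.add_sub_add_right]
    -- For `j = m` the subtraction `m - (j + 1)` is truncated, but its binomial coefficient
    -- vanishes.
    rcases (Nat.lt_succ_iff.1 (Finset.mem_range.1 hj)).eq_or_lt with rfl | hj'
    · rw [Nat.choose_succ_self]
      push_cast
      ring
    · rw [show m - j = (m - (j + 1)) + 1 by omega]
      push_cast
      ring
  · simp
    ring

theorem bernsteinEval_nonneg {b : ℕ → ℝ} {s : ℝ} (hb : ∀ i, 0 ≤ b i) (hs : 0 ≤ s) (hs1 : s ≤ 1)
    (m : ℕ) : 0 ≤ bernsteinEval m b s := by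
  induction m generalizing b with
  | zero => simpa [bernsteinEval, bernsteinPolynomial] using hb 0
  | succ m ih =>
    rw [bernsteinEval_succ]
    exact add_nonneg (mul_nonneg (by linarith) (ih hb)) (mul_nonneg hs (ih fun i => hb _))

/-- Bounds for the computed coefficient and its round-off errors at one step of the algorithm. -/
theorem coeffStep_bound {u s r x y P₁ P₂ d π₁ π₂ σ G : ℝ}
    (hu : 0 ≤ u) (hs : 0 ≤ s) (hs1 : s ≤ 1) (hG : (1 + u) ^ 3 ≤ G)
    (hr : |r| ≤ (1 + u) * (1 - s)) (hP₁ : |P₁| ≤ (1 + u) * |r * x|) (hπ₁ : |π₁| ≤ u * |r * x|)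
    (hP₂ : |P₂| ≤ (1 + u) * |s * y|) (hπ₂ : |π₂| ≤ u * |s * y|)
    (hd : |d| ≤ (1 + u) * |P₁ + P₂|) (hσ : |σ| ≤ u * |P₁ + P₂|) :
    |d| ≤ G * ((1 - s) * |x| + s * |y|) ∧
    |π₁| + |π₂| + |σ| + u * ((1 - s) * |x|) ≤ u * G * (3 * ((1 - s) * |x| + s * |y|)) := by
  have hg : 1 ≤ 1 + u := by linarith
  have hsy : |s * y| = s * |y| := by rw [abs_mul, abs_of_nonneg hs]
  have hrx : |r * x| ≤ (1 + u) * ((1 - s) * |x|) := by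
    rw [abs_mul, ← mul_assoc]; gcongr
  have ha : 0 ≤ s * |y| := by positivity
  have hc : 0 ≤ (1 - s) * |x| := mul_nonneg (by linarith) (abs_nonneg _)
  rw [hsy] at hP₂ hπ₂
  generalize s * |y| = a at *
  generalize (1 - s) * |x| = c at *
  have hG2 : (1 + u) ^ 2 ≤ G := (pow_le_pow_right₀ hg (by omega)).trans hG
  have hG1 : 1 + u ≤ G := (le_self_pow₀ hg (by omega)).trans hG
  have hG0 : 1 ≤ G := hg.trans hG1
  have b₁ : |P₁ + P₂| ≤ (1 + u) ^ 2 * (c + a) := by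
    calc |P₁ + P₂| ≤ (1 + u) * ((1 + u) * c) + (1 + u) * a := by
          refine (abs_add_le _ _).trans (add_le_add (hP₁.trans ?_) hP₂)
          gcongr
      _ ≤ (1 + u) * ((1 + u) * c) + (1 + u) * ((1 + u) * a) := by
          gcongr; exact le_mul_of_one_le_left ha hg
      _ = _ := by ring
  constructor
  · calc |d| ≤ (1 + u) * ((1 + u) ^ 2 * (c + a)) := hd.trans (by gcongr)
      _ = (1 + u) ^ 3 * (c + a) := by ring
      _ ≤ _ := by gcongr
  · have e₁ : |π₁| ≤ u * (G * c) := hπ₁.trans (by gcongr; exact hrx.trans (by gcongr))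
    have e₂ : |π₂| ≤ u * (G * a) := hπ₂.trans (by gcongr; exact le_mul_of_one_le_left ha hG0)
    have e₃ : |σ| ≤ u * (G * (c + a)) := hσ.trans (by gcongr; exact b₁.trans (by gcongr))
    have e₄ : u * c ≤ u * (G * c) := by gcongr; exact le_mul_of_one_le_left hc hG0
    have e₅ : 0 ≤ u * (G * a) := by positivity
    linarith

namespace FloatArith

variable {A : FloatArith}

/-- The bounds for the values at a node after `m` rounds, where `B` is the exact value and `T` the
exact value for the moduli of the coefficients. -/
structure IsNodeBound (A : FloatArith) (c : ℝ) (k m : ℕ) (H T B : ℝ) (X : Node) : Prop where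
  isFlt_coeff : IsFlt A.prec X.coeff
  isFlt_errs : ∀ x ∈ X.errs, IsFlt A.prec x
  length_eq : X.errs.length = k
  abs_coeff_le : |X.coeff| ≤ H * T
  abs_errs_le : ∀ i (hi : i < X.errs.length),
    |X.errs[i]| ≤ errCoeff c m (i + 1) * A.unitRoundoff ^ (i + 1) * H * T
  abs_sub_le : |B - (X.coeff + X.errs.sum)| ≤
    errCoeff c m (k + 1) * A.unitRoundoff ^ (k + 1) * H * T

/-- One round adds the local coefficient to the accumulated one. Averaging with weights `1 - s` and
`s` amplifies nothing, and the surplus powers of `1 + u` are collected in `H`, so the coefficients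
stay independent of `u`. -/
theorem isNodeBound_update {M k m : ℕ} {s r ρ H Tx Ty Bx By : ℝ} {X Y : Node} (hp : 4 ≤ A.prec)
    (hM : 6 * k + 3 ≤ M) (hw : A.IsWeight s r ρ) (hH : 0 ≤ H) (hTx : 0 ≤ Tx) (hTy : 0 ≤ Ty)
    (hX : A.IsNodeBound (M + 4) k m H Tx Bx X) (hY : A.IsNodeBound (M + 4) k m H Ty By Y)
    (h : (A.update s r ρ X Y).noUnderflow) :
    A.IsNodeBound (M + 4) k (m + 1) (H * ((1 + A.unitRoundoff) ^ (M + 4)) ^ (k + 2))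
      ((1 - s) * Tx + s * Ty) ((1 - s) * Bx + s * By) (A.update s r ρ X Y).val := by
  have hp1 : 1 ≤ A.prec := by omega
  have hu := A.unitRoundoff_pos
  simp only [update, FloatRun.noUnderflow_bind, FloatRun.val_bind, FloatRun.val_pure,
    FloatRun.noUnderflow_pure] at h ⊢
  obtain ⟨h1, h2, h3, h4, -⟩ := h
  have B1 := isErrorFree_twoProd hp hw.isFlt_fst hX.isFlt_coeff h1
  set P₁ := (A.twoProd r X.coeff).val
  have B2 := isErrorFree_twoProd hp hw.isFlt hY.isFlt_coeff h2
  set P₂ := (A.twoProd s Y.coeff).val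
  have B3 := isErrorFree_twoSum hp1 B1.isFlt_fst B2.isFlt_fst h3
  set d := (A.twoSum P₁.1 P₂.1).val
  have hs := hw.nonneg
  have hs1 : 0 ≤ 1 - s := by linarith [hw.le_one]
  set T := (1 - s) * Tx + s * Ty with hTdef
  have hT : 0 ≤ T := by positivity
  set u := A.unitRoundoff
  have hg : 1 ≤ 1 + u := by linarith
  set G := (1 + u) ^ (M + 4) with hG
  have hG1 : 1 ≤ G := one_le_pow₀ hg
  have hGpow {i j : ℕ} (hij : i ≤ j) : G ^ i ≤ G ^ j := pow_le_pow_right₀ hG1 hij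
  have hG0 : 0 ≤ G := by linarith
  obtain ⟨K1, K2⟩ := coeffStep_bound (G := G) hu.le hs hw.le_one (pow_le_pow_right₀ hg (by omega))
    hw.abs_fst_le B1.abs_fst_le B1.abs_snd_le B2.abs_fst_le B2.abs_snd_le B3.abs_fst_le
    B3.abs_snd_le
  have hXY : (1 - s) * |X.coeff| + s * |Y.coeff| ≤ H * T := by
    have e1 := mul_le_mul_of_nonneg_left hX.abs_coeff_le hs1
    have e2 := mul_le_mul_of_nonneg_left hY.abs_coeff_le hs
    rw [hTdef]
    linarith
  set c : ℝ := M + 4 with hc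
  have hc0 : 0 ≤ c := by positivity
  have hf := errCoeff_nonneg hc0 m
  have ha := localCoeff_nonneg hc0 hf
  set f := errCoeff c m with hfdef
  set a := localCoeff c f with hadef
  have hρX : |ρ * X.coeff| ≤ u * ((1 - s) * |X.coeff|) := by
    rw [abs_mul, ← mul_assoc]
    gcongr
    exact hw.abs_snd_le
  have hzlen : (X.errs.zip Y.errs).length = k := by
    rw [List.length_zip, hX.length_eq, hY.length_eq, min_self]
  -- Position `i` holds the group `i + 1`, hence the shifted indices. A further factor `G` per group
  -- makes the recursion of `localCoeff` meet the hypothesis on `q`.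
  have I := isErrorGroups_errorGroups (M := M) (Tx := Tx) (Ty := Ty) hp hw (X.errs.zip Y.errs)
    [P₁.2, P₂.2, d.2] X.coeff (fun i => a (i + 1) * u ^ (i + 1) * H * G ^ (i + 1))
    (fun i => f (i + 1) * u ^ (i + 1) * H)
    (by simp only [hzlen, List.length_cons, List.length_nil]; omega)
    (by
      intro t ht
      simp only [List.mem_cons, List.not_mem_nil, or_false] at ht
      rcases ht with rfl | rfl | rfl
      exacts [B1.isFlt_snd, B2.isFlt_snd, B3.isFlt_snd])
    hX.isFlt_coeff
    (fun z hz => ⟨hX.isFlt_errs _ (List.of_mem_zip hz).1, hY.isFlt_errs _ (List.of_mem_zip hz).2⟩)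
    (fun i hi => by
      rw [List.getElem_zip]
      exact ⟨hX.abs_errs_le i _, hY.abs_errs_le i _⟩)
    hT
    (by
      simp only [absSum_cons, absSum_nil]
      have ha1 : a (0 + 1) = 3 := by
        simp [hadef, localCoeff, hfdef, errCoeff_zero_right]
      rw [ha1]
      have e1 : u * G * (3 * ((1 - s) * |X.coeff| + s * |Y.coeff|)) ≤ u * G * (3 * (H * T)) := by
        gcongr
      simp only [zero_add, pow_one]
      linarith)
    (fun i => by
      have e1 : a (i + 1 + 1) = c * a (i + 1) + 3 * f (i + 1) := by rw [hadef, localCoeff]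
      have e2 : G ≤ G ^ (i + 2) := le_self_pow₀ hG1 (by omega)
      have e3 : 0 ≤ u ^ (i + 2) * (3 * f (i + 1) * H) := by have := hf (i + 1); positivity
      have e4 := mul_le_mul_of_nonneg_left e2 e3
      rw [e1]
      calc _ = u ^ (i + 2) * (c * a (i + 1) * H) * G ^ (i + 2) +
            u ^ (i + 2) * (3 * f (i + 1) * H) * G := by ring
        _ ≤ u ^ (i + 2) * (c * a (i + 1) * H) * G ^ (i + 2) +
            u ^ (i + 2) * (3 * f (i + 1) * H) * G ^ (i + 2) := by gcongr
        _ = _ := by ring)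
    h4
  set ds := (A.errorGroups s r ρ [P₁.2, P₂.2, d.2] X.coeff (X.errs.zip Y.errs)).val
  have hstep (F : ℕ) : errCoeff c (m + 1) F = f F + a F := by rw [errCoeff]
  obtain ⟨R', hR', hsum⟩ := I.exists_remainder
  rw [hzlen] at hR'
  refine ⟨B3.isFlt_fst, I.isFlt, I.length_eq.trans hzlen, ?_, fun i hi => ?_, ?_⟩
  · calc |d.1| ≤ G * (H * T) := K1.trans (by gcongr)
      _ = H * G ^ 1 * T := by ring
      _ ≤ _ := by gcongr ?_ * T; gcongr _ * ?_; exact hGpow (by omega)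
  · have hik : i < k := by
      have : ds.length = k := I.length_eq.trans hzlen
      exact this ▸ hi
    refine (I.abs_le i hi).trans ?_
    gcongr ?_ * T
    rw [hstep]
    have := hf (i + 1)
    have := ha (i + 1)
    calc _ = a (i + 1) * u ^ (i + 1) * H * G ^ (i + 2) + f (i + 1) * u ^ (i + 1) * H * G ^ 1 := by
          ring
      _ ≤ a (i + 1) * u ^ (i + 1) * H * G ^ (k + 2) +
          f (i + 1) * u ^ (i + 1) * H * G ^ (k + 2) := by
          gcongr _ * ?_ + _ * ?_ <;> exact hGpow (by omega)
      _ = _ := by ring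
  -- The coefficient plus its errors follows the exact recursion, so the defect is the average of
  -- the two old defects plus the new remainder.
  · have hval : (1 - s) * Bx + s * By - (d.1 + ds.sum) =
        (1 - s) * (Bx - (X.coeff + X.errs.sum)) + s * (By - (Y.coeff + Y.errs.sum)) + R' := by
      rw [hsum, List.map_snd_zip (by rw [hX.length_eq, hY.length_eq]),
        List.map_fst_zip (by rw [hX.length_eq, hY.length_eq])]
      simp only [List.sum_cons, List.sum_nil]
      linear_combination -X.coeff * hw.add_eq - B1.add_eq - B2.add_eq - B3.add_eq
    have e1 := mul_le_mul_of_nonneg_left hX.abs_sub_le hs1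
    have e2 := mul_le_mul_of_nonneg_left hY.abs_sub_le hs
    have := hf (k + 1)
    have := ha (k + 1)
    show |(1 - s) * Bx + s * By - (d.1 + ds.sum)| ≤ _
    rw [hval, hstep]
    calc _ ≤ (1 - s) * |Bx - (X.coeff + X.errs.sum)| + s * |By - (Y.coeff + Y.errs.sum)| +
          |R'| := by
            refine (abs_add_le _ _).trans (add_le_add ((abs_add_le _ _).trans_eq ?_) le_rfl)
            rw [abs_mul, abs_mul, abs_of_nonneg hs1, abs_of_nonneg hs]
      _ ≤ f (k + 1) * u ^ (k + 1) * H * G ^ 0 * T +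
          a (k + 1) * u ^ (k + 1) * H * G ^ (k + 1) * T := by
            rw [pow_zero, mul_one]
            refine add_le_add ((add_le_add e1 e2).trans_eq ?_) hR'
            rw [hTdef]; ring
      _ ≤ f (k + 1) * u ^ (k + 1) * H * G ^ (k + 2) * T +
          a (k + 1) * u ^ (k + 1) * H * G ^ (k + 2) * T := by
            gcongr ?_ * T + ?_ * T
            · gcongr _ * ?_; exact hGpow (by omega)
            · gcongr _ * ?_; exact hGpow (by omega)
      _ = _ := by ring

theorem isNodeBound_node {M k n : ℕ} {b : ℕ → ℝ} {s r ρ : ℝ} (hp : 4 ≤ A.prec)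
    (hM : 6 * k + 3 ≤ M) (hw : A.IsWeight s r ρ) (hb : ∀ j ≤ n, IsFlt A.prec (b j)) (m j : ℕ)
    (hmj : m + j ≤ n) (h : (A.node b (k + 1) s r ρ m j).noUnderflow) :
    A.IsNodeBound (M + 4) k m ((1 + A.unitRoundoff) ^ ((M + 4) * (k + 2) * m))
      (bernsteinEval m (fun i => |b (j + i)|) s) (bernsteinEval m (fun i => b (j + i)) s)
      (A.node b (k + 1) s r ρ m j).val := by
  have hu := A.unitRoundoff_pos
  induction m generalizing j with
  | zero =>
    simp only [node, FloatRun.val_pure]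
    refine ⟨hb j (by omega), ?_, by simp, ?_, ?_, ?_⟩
    · intro x hx
      rw [List.eq_of_mem_replicate hx]
      exact isFlt_zero _
    · simp [bernsteinEval, bernsteinPolynomial]
    · intro i hi
      simp [errCoeff]
    · simp [bernsteinEval, bernsteinPolynomial, errCoeff]
  | succ m ih =>
    simp only [node, FloatRun.noUnderflow_bind, FloatRun.val_bind] at h ⊢
    have hX := ih j (by omega) h.1
    have hY := ih (j + 1) (by omega) h.2.1
    have hT (j : ℕ) : 0 ≤ bernsteinEval m (fun i => |b (j + i)|) s :=
      bernsteinEval_nonneg (fun i => abs_nonneg _) hw.nonneg hw.le_one m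
    have H := isNodeBound_update hp hM hw (by positivity) (hT j) (hT (j + 1)) hX hY h.2.2
    rw [bernsteinEval_succ, bernsteinEval_succ]
    have e1 : (1 + A.unitRoundoff) ^ ((M + 4) * (k + 2) * m) *
        ((1 + A.unitRoundoff) ^ (M + 4)) ^ (k + 2) =
        (1 + A.unitRoundoff) ^ ((M + 4) * (k + 2) * (m + 1)) := by
      rw [← pow_mul, ← pow_add]; congr 1
    have shift (f : ℕ → ℝ) : (fun i => f (j + (i + 1))) = fun i => f (j + 1 + i) :=
      funext fun i => congrArg f (by ring)
    have e2 : (fun i => |b (j + (i + 1))|) = fun i => |b (j + 1 + i)| := shift fun i => |b i|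
    rw [shift b, e2]
    rwa [e1] at H

end FloatArith

/-! ### Assembling the final estimate -/

theorem absSum_le_sum_range (l : List ℝ) (f : ℕ → ℝ)
    (h : ∀ i (hi : i < l.length), |l[i]| ≤ f i) : absSum l ≤ ∑ i ∈ Finset.range l.length, f i := by
  induction l generalizing f with
  | nil => simp [absSum_nil]
  | cons x l ih =>
    rw [absSum_cons, List.length_cons, Finset.sum_range_succ', add_comm]
    exact add_le_add (ih (fun i => f (i + 1)) fun i hi => h (i + 1) (Nat.succ_lt_succ hi))
      (h 0 (Nat.succ_pos _))

/-- A crude bound suffices: `3 ^ N` enters `C₃` only, which may depend on `n`. -/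
theorem one_add_pow_le_one_add_three_pow_mul {u : ℝ} (hu : 0 ≤ u) (hu1 : u ≤ 1) (N : ℕ) :
    (1 + u) ^ N ≤ 1 + 3 ^ N * u := by
  induction N with
  | zero => simpa using hu
  | succ N ih =>
    have h1 : (1 : ℝ) ≤ 3 ^ N := one_le_pow₀ (by norm_num)
    have h2 : u ≤ 3 ^ N * u := le_mul_of_one_le_left hu h1
    have h3 : 3 ^ N * u * u ≤ 3 ^ N * u := mul_le_of_le_one_right (by positivity) hu1
    calc (1 + u) ^ (N + 1) = (1 + u) ^ N * (1 + u) := pow_succ _ _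
      _ ≤ (1 + 3 ^ N * u) * (1 + u) := by gcongr
      _ ≤ _ := by rw [pow_succ]; linarith

/-- The error of the compensated result, from those of the compensation and of the final
summation. -/
theorem compensated_error_bound {u C x D E H T B p V res : ℝ} {K : ℕ} (hu : 0 ≤ u) (hu1 : u ≤ 1)
    (hC : 0 ≤ C) (hx : 0 ≤ x) (hD : 0 ≤ D) (hE : 0 ≤ E) (hT : 0 ≤ T)
    (hH0 : 0 ≤ H) (hH : H ≤ 1 + E * u) (hB : B ≤ (1 + u * D) * H * T)
    (hV : |p - V| ≤ x * u ^ K * H * T)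
    (hres : |res - V| ≤ (u + C * u ^ 2) * |V| + C * u ^ K * B) :
    |p - res| ≤ (u + C * u ^ 2) * |p| +
      ((x + C) * u ^ K + (x * (E + (1 + C) * (1 + E)) + C * (E + D * (1 + E))) * u ^ (K + 1)) *
        T := by
  have hEu : E * u ≤ E := mul_le_of_le_one_right hE hu1
  have hu2 : u ^ 2 ≤ u := by rw [sq]; exact mul_le_of_le_one_right hu hu1
  have h1 : |p - res| ≤ |p - V| + |res - V| := by
    rw [abs_sub_comm res V]; exact abs_sub_le _ _ _
  have h2 : |V| ≤ |p| + |p - V| := by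
    have := abs_sub p (p - V)
    rwa [sub_sub_cancel] at this
  have h3 : (1 + u + C * u ^ 2) * H ≤ 1 + u * (E + (1 + C) * (1 + E)) := by
    calc (1 + u + C * u ^ 2) * H ≤ (1 + u + C * u) * (1 + E * u) := by gcongr
      _ = 1 + E * u + u * (1 + C) * (1 + E * u) := by ring
      _ ≤ 1 + E * u + u * (1 + C) * (1 + E) := by gcongr
      _ = _ := by ring
  have h4 : (1 + u * D) * H ≤ 1 + u * (E + D * (1 + E)) := by
    calc (1 + u * D) * H ≤ (1 + u * D) * (1 + E * u) := by gcongr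
      _ = 1 + E * u + u * D * (1 + E * u) := by ring
      _ ≤ 1 + E * u + u * D * (1 + E) := by gcongr
      _ = _ := by ring
  calc |p - res| ≤ |p - V| + ((u + C * u ^ 2) * (|p| + |p - V|) + C * u ^ K * B) := by
        refine h1.trans (add_le_add le_rfl (hres.trans ?_))
        gcongr
    _ = (u + C * u ^ 2) * |p| + ((1 + u + C * u ^ 2) * |p - V| + C * u ^ K * B) := by ring
    _ ≤ (u + C * u ^ 2) * |p| + ((1 + u + C * u ^ 2) * (x * u ^ K * H * T) +
        C * u ^ K * ((1 + u * D) * H * T)) := by gcongr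
    _ = (u + C * u ^ 2) * |p| + (x * u ^ K * T * ((1 + u + C * u ^ 2) * H) +
        C * u ^ K * T * ((1 + u * D) * H)) := by ring
    _ ≤ (u + C * u ^ 2) * |p| + (x * u ^ K * T * (1 + u * (E + (1 + C) * (1 + E))) +
        C * u ^ K * T * (1 + u * (E + D * (1 + E)))) := by gcongr
    _ = _ := by ring

theorem FloatArith.isWeight_twoSum {A : FloatArith} {s : ℝ} (hp : 1 ≤ A.prec)
    (hs : IsFlt A.prec s) (hs01 : s ∈ Set.Icc (0 : ℝ) 1) (h : (A.twoSum 1 (-s)).noUnderflow) :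
    A.IsWeight s (A.twoSum 1 (-s)).val.1 (A.twoSum 1 (-s)).val.2 := by
  have H := isErrorFree_twoSum hp (isFlt_one hp) hs.neg h
  have h1 := H.abs_fst_le
  have h2 := H.abs_snd_le
  rw [← sub_eq_add_neg, abs_of_nonneg (sub_nonneg.2 hs01.2)] at h1 h2
  exact ⟨hs01.1, hs01.2, hs, H.isFlt_fst, H.isFlt_snd, H.add_eq.trans (sub_eq_add_neg _ _).symm,
    h1, h2⟩

theorem FloatArith.four_le_prec {A : FloatArith} (h : A.unitRoundoff ≤ 2 ^ (-4 : ℤ)) :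
    4 ≤ A.prec := by
  have := (zpow_le_zpow_iff_right₀ (one_lt_two (α := ℝ))).1 h
  omega

theorem mainTheorem1 (K : ℕ) (hK : 1 ≤ K) :
    ∃ C₁ C₂ : ℝ, ∀ n : ℕ, 2 ≤ n → ∃ C₃ u₀ : ℝ, 0 < u₀ ∧
      ∀ (A : FloatArith) (b : ℕ → ℝ) (s : ℝ),
        A.unitRoundoff ≤ u₀ →
        (∀ j ≤ n, IsFloat A.prec A.emin (b j)) →
        IsFloat A.prec A.emin s →
        s ∈ Set.Icc (0 : ℝ) 1 →
        (A.compDeCasteljauK n b s K).noUnderflow →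
        bernsteinEval n b s ≠ 0 →
        |bernsteinEval n b s - (A.compDeCasteljauK n b s K).val| / |bernsteinEval n b s| ≤
          (A.unitRoundoff + C₁ * A.unitRoundoff ^ 2) +
            ((3 ^ K * (n.choose K : ℝ) + C₂ * (n : ℝ) ^ (K - 1)) * A.unitRoundoff ^ K +
              C₃ * A.unitRoundoff ^ (K + 1)) * bernsteinCond n b s := by
  obtain ⟨k, rfl⟩ : ∃ k, K = k + 1 := ⟨K - 1, by omega⟩
  obtain ⟨C, hC, hsumK⟩ := FloatArith.exists_sumAfterPasses_bound k k
  -- Three errors enter the first group, and each of the `k` groups adds at most six.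
  set M := 6 * k + 3 with hM
  have hc : (0 : ℝ) ≤ M + 4 := by positivity
  obtain ⟨C', hC', hcoeff⟩ := exists_errCoeff_le hc k
  -- `C` comes from the final summation, `C'` from the error coefficients; both depend on `K` only.
  -- The term `C * u ^ K` is absorbed using `1 ≤ n ^ k`.
  refine ⟨C, C' + C, fun n hn => ?_⟩
  set x := errCoeff (M + 4) n (k + 1)
  set D := ∑ i ∈ Finset.range k, errCoeff (M + 4) n (i + 1)
  set N := (M + 4) * (k + 2) * n
  -- The first witness is the coefficient of `u ^ (K + 1)` in `compensated_error_bound` with `E = 3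
  -- ^ N`. The second forces `prec ≥ 4`, so that `r = ⌈prec / 2⌉` satisfies `r + 2 ≤ prec`, as
  -- exactness of `TwoProd` is proved under this condition.
  refine ⟨x * (3 ^ N + (1 + C) * (1 + 3 ^ N)) + C * (3 ^ N + D * (1 + 3 ^ N)), 2 ^ (-4 : ℤ),
    by positivity, fun A b s hu₀ hb hs hs01 h hp0 => ?_⟩
  have hp := FloatArith.four_le_prec hu₀
  have hp1 : 1 ≤ A.prec := by omega
  have hu := A.unitRoundoff_pos
  have hu1 : A.unitRoundoff ≤ 1 := hu₀.trans (zpow_le_one_of_nonpos₀ one_le_two (by norm_num))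
  simp only [FloatArith.compDeCasteljauK, FloatArith.sumK, FloatRun.noUnderflow_bind,
    FloatRun.val_bind, Nat.add_sub_cancel] at h ⊢
  obtain ⟨h1, h2, h3⟩ := h
  have hw := FloatArith.isWeight_twoSum hp1 hs.isFlt hs01 h1
  have hN := FloatArith.isNodeBound_node hp hM.ge hw (fun j hj => (hb j hj).isFlt) n 0 le_rfl h2
  simp only [zero_add] at hN
  set X := (A.node b (k + 1) s (A.twoSum 1 (-s)).val.1 (A.twoSum 1 (-s)).val.2 n 0).val
  set u := A.unitRoundoff
  set T := bernsteinEval n (fun j => |b j|) s with hT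
  have hT0 : 0 ≤ T := bernsteinEval_nonneg (fun i => abs_nonneg _) hs01.1 hs01.2 n
  have hR := hsumK A (X.coeff :: X.errs) hp1 hu1 (by rw [List.length_cons, hN.length_eq])
    (by
      intro t ht
      rcases List.mem_cons.1 ht with rfl | ht
      exacts [hN.isFlt_coeff, hN.isFlt_errs t ht]) h3
  rw [List.sum_cons] at hR
  have hB : absSum (X.coeff :: X.errs).dropLast ≤ (1 + u * D) * (1 + u) ^ N * T := by
    refine (absSum_dropLast_le _).trans ?_
    have e1 := absSum_le_sum_range X.errs _ hN.abs_errs_le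
    rw [hN.length_eq] at e1
    rw [absSum_cons]
    calc _ ≤ (1 + u) ^ N * T + ∑ i ∈ Finset.range k,
          errCoeff (M + 4) n (i + 1) * u ^ (i + 1) * (1 + u) ^ N * T :=
          add_le_add hN.abs_coeff_le e1
      _ ≤ (1 + u) ^ N * T + ∑ i ∈ Finset.range k,
          errCoeff (M + 4) n (i + 1) * u * (1 + u) ^ N * T := by
          gcongr with i hi
          · exact errCoeff_nonneg hc _ _
          · exact pow_le_of_le_one hu.le hu1 (by omega)
      _ = _ := by
          rw [← Finset.sum_mul, ← Finset.sum_mul, ← Finset.sum_mul]; ring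
  have key := compensated_error_bound hu.le hu1 hC (errCoeff_nonneg hc n (k + 1))
    (Finset.sum_nonneg fun i _ => errCoeff_nonneg hc n (i + 1)) (by positivity) hT0
    (by positivity) (one_add_pow_le_one_add_three_pow_mul hu.le hu1 N) hB hN.abs_sub_le hR
  have hn1 : (1 : ℝ) ≤ (n : ℝ) ^ k := one_le_pow₀ (by exact_mod_cast (by omega : 1 ≤ n))
  have hx : x + C ≤ 3 ^ (k + 1) * n.choose (k + 1) + (C' + C) * n ^ k := by
    have := (hcoeff n).2
    have := le_mul_of_one_le_right hC hn1
    linarith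
  have hpos : 0 < |bernsteinEval n b s| := abs_pos.2 hp0
  rw [bernsteinCond, ← hT, div_le_iff₀ hpos, add_mul, mul_assoc (_ + _) (T / _),
    div_mul_cancel₀ _ hpos.ne']
  refine key.trans ?_
  gcongr
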